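/- Let $\mathbb{F}_4=\{0,1,\omega,\bar\omega\}$ be the field with four elements, where $\bar\omega=\omega^2=\omega+1$. An additive $\mathbb{F}_4$-code $C$ of length $n$ is an additive subgroup of $\mathbb{F}_4^n$; it is self-dual if $C=\{x\in\mathbb{F}_4^n : \sum_{i=1}^n (x_iy_i^2+x_i^2y_i)=0 \text{ for all } y\in C\}$, and its minimum weight is the smallest number of non-zero components of a non-zero codeword. There is a self-dual additive $\mathbb{F}_4$-code of length $66$ and minimum weight $17$. Explicitly, let $A$ and $B$ be the $33\times 33$ circulant $(1,0)$-matrices (each row being the cyclic shift of the previous row by one position to the right) whose first rows have supports, with coordinates numbered $1,\dots,33$, $$\{2,3,4,5,6,8,12,13,14,16,17,18,19,21,22,23,27,29,30,31,32,33\}$$ and $$\{3,4,5,8,10,11,12,16,20,21,25,26,28,29,30,33\},$$ respectively. Then $A$ is symmetric with zero diagonal, and the additive $\mathbb{F}_4$-code $C_{66}=C(A,B)$ of length $66$ generated (as an additive group) by the rows of $$\begin{pmatrix} A & B\\ B^T & A\end{pmatrix}+\omega I$$ is self-dual and has minimum weight $17$. -/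

import Mathlib

open scoped Matrix

namespace AdditiveCode

/-- The trace inner product `x * y = ∑ i, (x i * (y i)^2 + (x i)^2 * y i)`
(for vectors over the field with four elements). -/
def traceInner {F : Type*} [Field F] {n : ℕ} (x y : Fin n → F) : F :=
  ∑ i, (x i * y i ^ 2 + x i ^ 2 * y i)

/-- The dual of an additive code of length `n`, with respect to the trace inner product. -/
def dual {F : Type*} [Field F] {n : ℕ} (C : AddSubgroup (Fin n → F)) : Set (Fin n → F) :=
  {x | ∀ y ∈ C, traceInner x y = 0}

/-- An additive code is self-dual if it equals its dual. -/
def IsSelfDual {F : Type*} [Field F] {n : ℕ} (C : AddSubgroup (Fin n → F)) : Prop :=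
  (C : Set (Fin n → F)) = dual C

/-- `d` is the minimum weight of `C`: the least number of non-zero components of a non-zero
codeword (attained). -/
def HasMinimumWeight {F : Type*} [Field F] [DecidableEq F] {n : ℕ}
    (C : AddSubgroup (Fin n → F)) (d : ℕ) : Prop :=
  IsLeast {w : ℕ | ∃ x ∈ C, x ≠ 0 ∧ hammingNorm x = w} d

/-- The `(1,0)`-vector of length `n` whose support, with coordinates numbered `1, …, n`,
is `S`. -/
def vectorOfSupport (F : Type*) [Field F] (n : ℕ) (S : Finset ℕ) : Fin n → F :=
  fun j => if (j : ℕ) + 1 ∈ S then 1 else 0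

/-- The circulant matrix with first row `r`: its `(i, j)` entry is `r (j - i)`, indices taken
modulo `n` (Mathlib's `Matrix.circulant r` has first column `r`, hence the transpose). -/
def circulantOfFirstRow {F : Type*} {n : ℕ} (r : Fin n → F) : Matrix (Fin n) (Fin n) F :=
  (Matrix.circulant r)ᵀ

/-- The block matrix with block rows `(A, B)` and `(Bᵀ, A)`. -/
def blockMatrix {F : Type*} {n : ℕ} (A B : Matrix (Fin n) (Fin n) F) :
    Matrix (Fin (n + n)) (Fin (n + n)) F :=
  Matrix.reindex finSumFinEquiv finSumFinEquiv (Matrix.fromBlocks A B Bᵀ A)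

/-- The additive code generated by the rows of a matrix. -/
def rowCode {F : Type*} [Field F] {m n : ℕ} (G : Matrix (Fin m) (Fin n) F) :
    AddSubgroup (Fin n → F) :=
  AddSubgroup.closure (Set.range fun i => G i)

/-- The additive code `C(A, B)` generated by the rows of `M(A, B) + ω I`. -/
def pairCode {F : Type*} [Field F] {n : ℕ} (ω : F) (A B : Matrix (Fin n) (Fin n) F) :
    AddSubgroup (Fin (n + n) → F) :=
  rowCode (blockMatrix A B + ω • (1 : Matrix (Fin (n + n)) (Fin (n + n)) F))

/-- The circulant matrix `A` of order `33` for the code of length `66`. -/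
def A66 (F : Type*) [Field F] : Matrix (Fin 33) (Fin 33) F :=
  circulantOfFirstRow (vectorOfSupport F 33
    {2, 3, 4, 5, 6, 8, 12, 13, 14, 16, 17, 18, 19, 21, 22, 23, 27, 29, 30, 31, 32, 33})

/-- The circulant matrix `B` of order `33` for the code of length `66`. -/
def B66 (F : Type*) [Field F] : Matrix (Fin 33) (Fin 33) F :=
  circulantOfFirstRow (vectorOfSupport F 33
    {3, 4, 5, 8, 10, 11, 12, 16, 20, 21, 25, 26, 28, 29, 30, 33})

/-- The code `C(A, B)` of length `66` for the two matrices above. -/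
def C66 {F : Type*} [Field F] (ω : F) : AddSubgroup (Fin 66 → F) :=
  pairCode ω (A66 F) (B66 F)

end AdditiveCode

/-!
The code is `{M x + ω x}`, where `M` is the symmetric matrix with blocks `A`, `B`, `Bᵀ`, `A` and `x`
runs through the vectors over `𝔽₂`. For every symmetric `M` over the prime field such a code is
self-dual (`isSelfDual_rowCode`): the trace inner product of `u + ω v` with the row `i` of `M + ω I`
is `u i + (M v) i`, so that the dual consists of the vectors with `u = M v`.

The point is the lower bound `17` for the minimum weight, which is an exhaustive search. It is
arranged so that the kernel can evaluate it, on binary natural numbers only. A codeword is encoded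
by a number of `132` bits, and the encoded code is the `𝔽₂`-span of `gens`.

*Reduction by symmetry.* The simultaneous rotation of both halves of the coordinates by one place
preserves the code, and so does the exchange of the halves combined with reversing them
(`exists_rot`, `exists_swap`). Hence for a word of weight at most `16` the left weight `a` is at
most `8` without loss of generality, and the right weight is at most `16 - a`. There are five cases,
by the value of `a`. Each half is divided into eleven triples of coordinates, the cosets of the
subgroup of order three of `ℤ / 33`. In each case there are a set `L` of triples and a list of sets
`R` of triples with bounds `r` such that every word has, after a rotation, weight at most `p + 1` on
`L` in the left half, and weight at most `r` on one of the sets `R` in the right half. As only the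
weights on the triples matter, this is a small combinatorial statement (`Case.covered`). A further
rotation by a multiple of `11` puts the first nonzero coordinate in `L` into the first position of
its triple.

*Search.* For each pair of `L` and `R`, the corresponding coordinates contain an information set: a
codeword is determined by its restriction to them, as a combination of the words of a reduced basis
(`pivots`). So it is the sum of a word `w` in a list that depends only on the left coordinates
(`leadWords`) and of a word `u` from a shorter list for the right ones (`words`). For each `u`, the
weights of all the sums `w + u` are computed simultaneously: for each coordinate, a natural number
has as its bits the values of all the words `w` there, and these numbers are added by bitwise
operations, as by the full adders of a circuit (`overflow`). That every sum has weight at least `17`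
unless it vanishes is then a single equation between natural numbers (`rejects`, `le_of_rejects`).

That `17` is attained is seen from the explicit codeword `word17`.
-/

namespace AdditiveCode

/-! ### Words as natural numbers -/

/-- A coordinate `pos` of the code together with two words `a` and `b`. In a reduced basis, the
word `a` has bit `pos` and the word `b` has bit `66 + pos`, and no other word of the basis has one
of these bits. A bit that depends on those of the preceding pivots comes with the word `0`. -/
structure Pivot where
  pos : ℕ
  a : ℕ
  b : ℕ

/-- Bit `j` of `w` as a number. Here and below, arithmetic that matters for the running time is
written with the functions on natural numbers that the kernel evaluates on binary representations,
without unfolding type class instances. -/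
def bit (w j : ℕ) : ℕ := Nat.land (Nat.shiftRight w j) 1

/-- Bit `j` of `w`. -/
def tb (w j : ℕ) : Bool := Nat.beq (bit w j) 1

/-- Whether the codeword encoded by `w` is nonzero at the coordinate `v`: its entry there is
`a + b * ω`, where `b` is bit `v` of `w` and `a` is bit `66 + v`. -/
def nz (w v : ℕ) : Bool := tb w v || tb w (Nat.add 66 v)

/-! ### Gaussian elimination -/

/-- The first number in a list with bit `j` (`0` if there is none), and the other numbers. -/
def extract (j : ℕ) : List ℕ → ℕ × List ℕ
  | [] => (0, [])
  | r :: l => cond (tb r j) (r, l) ((extract j l).1, r :: (extract j l).2)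

/-- Clears bit `j` of all numbers of a list by adding `p` where necessary. -/
def clearBit (j p : ℕ) (l : List ℕ) : List ℕ :=
  l.map fun r => Nat.xor r (Nat.mul (bit r j) p)

/-- Gauss-Jordan elimination over `𝔽₂`: reduces `rows` with respect to the given bits, and
prepends the pivot rows, or `0` for a bit without pivot, to `done`, so that they come in the reverse
order of the bits. -/
def gauss : List ℕ → List ℕ → List ℕ → List ℕ
  | [], done, _ => done
  | j :: bits, done, rows =>
    gauss bits ((extract j rows).1 :: clearBit j (extract j rows).1 done)
      (clearBit j (extract j rows).1 (extract j rows).2)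

/-- Combines the reversed coordinates and the pivot rows found by `gauss` to pivots. -/
def pairUp : List ℕ → List ℕ → List Pivot
  | v :: vs, b :: a :: us => ⟨v, a, b⟩ :: pairUp vs us
  | _, _ => []

/-- The contribution of a pivot to the expansion of `w` in a reduced basis. -/
def part (w : ℕ) (e : Pivot) : ℕ :=
  Nat.xor (Nat.mul (bit w e.pos) e.a) (Nat.mul (bit w (Nat.add 66 e.pos)) e.b)

/-- The combination of the basis words that agrees with `w` in the pivot bits. -/
def combo (w : ℕ) : List Pivot → ℕ
  | [] => 0
  | e :: us => Nat.xor (part w e) (combo w us)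

/-! ### Enumeration of combinations -/

/-- The words of `l` plus a nonzero combination of the two words of a pivot. -/
def options (e : Pivot) (l : List ℕ) : List ℕ :=
  l.map (e.a ^^^ ·) ++ (l.map (e.b ^^^ ·) ++ l.map ((e.a ^^^ e.b) ^^^ ·))

/-- The combinations of the basis words that are nonzero at no more than `p` of the pivots. -/
def words : List Pivot → ℕ → List ℕ
  | [], _ => [0]
  | _ :: _, 0 => [0]
  | e :: us, p + 1 => words us (p + 1) ++ options e (words us p)

/-- The combinations of the basis words that are nonzero at no more than `p + 1` of the pivots and
whose first nonzero pivot is the first one of a triple, when the pivots are grouped in threes. -/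
def leadWords (p : ℕ) : List Pivot → List ℕ
  | e :: f :: g :: us => leadWords p us ++ options e (words (f :: g :: us) p)
  | _ => [0]

/-! ### Bit columns of lists of words

The bits at one position of all words of the list `words us p` form a natural number. It is
computed from the bits of the basis words at this position, without going through the list.
-/

/-- The column whose `n` bits are all set. -/
def ones (n : ℕ) : ℕ := 2 ^ n - 1

/-- The column `s` of length `n`, followed by three copies of the column `t` of length `m`. -/
def merge (n m s t : ℕ) : ℕ := s ^^^ (t ^^^ (t ^^^ t <<< m) <<< m) <<< n

/-- Applies `merge` to both components of all entries. -/
def mergeAll (n m : ℕ) : List (ℕ × ℕ) → List (ℕ × ℕ) → List (ℕ × ℕ)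
  | s :: ss, t :: ts => (merge n m s.1 t.1, merge n m s.2 t.2) :: mergeAll n m ss ts
  | _, _ => []

/-- A description of a list of combinations of basis words: the length of the list, and for each
pivot two columns, telling which of the combinations involve the word `a` and the word `b`. -/
abbrev Sel := ℕ × List (ℕ × ℕ)

/-- If `x` and `y` describe the lists `ws` and `ws'` of combinations, this describes the list
`ws ++ options e ws'` with an additional pivot `e` in front. -/
def nextSel (x y : Sel) : Sel :=
  (x.1 + 3 * y.1,
    ((ones y.1 ^^^ (ones y.1 <<< y.1) <<< y.1) <<< x.1,
      ((ones y.1 ^^^ ones y.1 <<< y.1) <<< y.1) <<< x.1) :: mergeAll x.1 y.1 x.2 y.2)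

/-- Adds a pivot in front that is not used. -/
def padSel (x : Sel) : Sel := (x.1, (0, 0) :: x.2)

/-- Passes from the descriptions of `words us q, words us (q + 1), …` to those with one more pivot,
except for the first one. -/
def stepTail : Sel → List Sel → List Sel
  | _, [] => []
  | y, x :: l => nextSel x y :: stepTail x l

/-- Passes from the descriptions of `words us 0, words us 1, …` to those with one more pivot. -/
def step : List Sel → List Sel
  | [] => []
  | x :: l => padSel x :: stepTail x l

/-- Adds a triple of pivots in `selector`. -/
def tripleStep (p : ℕ) (s : List Sel × Sel) : List Sel × Sel :=
  (step (step (step s.1)), nextSel (padSel (padSel s.2)) ((step (step s.1)).getD p (0, [])))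

/-- The descriptions of `words us 0, …, words us p` and of `leadWords p us` for a list `us` of
`3 * k` pivots. -/
def selector (p : ℕ) : ℕ → List Sel × Sel
  | 0 => (List.replicate (p + 1) (1, []), (1, []))
  | k + 1 => tripleStep p (selector p k)

/-- The column of bits `j` of the combinations of the words of a basis that a description lists. -/
def column (j : ℕ) : List Pivot → List (ℕ × ℕ) → ℕ
  | e :: us, s :: ss =>
    Nat.xor (Nat.mul (bit e.a j) s.1) (Nat.xor (Nat.mul (bit e.b j) s.2) (column j us ss))
  | _, _ => 0

/-! ### Counting in parallel

A list of columns, called bit planes, holds one counter in binary for each word of a list, least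
significant bits first.
-/

/-- Adds a column to the counters. -/
def addBit : List ℕ → ℕ → List ℕ
  | [], b => cond (Nat.beq b 0) [] [b]
  | p :: ps, b => cond (Nat.beq b 0) (p :: ps) (Nat.xor p b :: addBit ps (Nat.land p b))

/-- The carries when the column `s` and the columns of a list are added at one binary place: each
pair of columns goes through a full adder together with the sum bit so far. The final sum bit is
dropped. -/
def carries : List ℕ → ℕ → List ℕ
  | [], _ => []
  | [x], s => [Nat.land s x]
  | x :: y :: l, s =>
    Nat.lor (Nat.land x y) (Nat.land s (Nat.xor x y)) :: carries l (Nat.xor s (Nat.xor x y))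

/-- The bitwise disjunction of the columns of a list. -/
def orAll : List ℕ → ℕ
  | [] => 0
  | x :: l => Nat.lor x (orAll l)

/-- The lanes whose counter, held in the bit planes `ps`, overflows when the columns `xs` are
added. -/
def overflow : List ℕ → List ℕ → ℕ
  | [], xs => orAll xs
  | p :: ps, xs => overflow ps (carries xs p)

/-- The columns that tell which words `w + u` are nonzero at the coordinate `pos`, for the four
values of `u` there. -/
structure Quad where
  pos : ℕ
  c00 : ℕ
  c01 : ℕ
  c10 : ℕ
  c11 : ℕ

/-- The `Quad` for the coordinate `v`, from the columns `c` and `d` of bits `v` and `66 + v`. -/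
def mkQuad (v n c d : ℕ) : Quad :=
  ⟨v, Nat.lor c d, Nat.lor c (Nat.xor d (ones n)), Nat.lor (Nat.xor c (ones n)) d,
    Nat.lor (Nat.xor c (ones n)) (Nat.xor d (ones n))⟩

/-- The `Quad`s for the coordinates `vs` and the words described by `s`. -/
def quads (us : List Pivot) (s : Sel) (vs : List ℕ) : List Quad :=
  vs.map fun v => mkQuad v s.1 (column v us s.2) (column (66 + v) us s.2)

/-- The column of the words `w` such that `w + u` is nonzero at the coordinate of `q`. -/
def Quad.at (u : ℕ) (q : Quad) : ℕ :=
  cond (tb u q.pos) (cond (tb u (Nat.add 66 q.pos)) q.c11 q.c10)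
    (cond (tb u (Nat.add 66 q.pos)) q.c01 q.c00)

/-- Adds to the counters the numbers of coordinates of `qs` at which the words are nonzero. -/
def addQuads : List Quad → List ℕ → List ℕ
  | [], ps => ps
  | q :: qs, ps => addQuads qs (addBit ps (q.at 0))

/-- Whether all `n` words `w` yield an overflow of the counters `init` when the weights of `w + u` on
the coordinates of `qs` are added. If `u = 0`, the first word, which is `0`, is exempt. -/
def rejects (n : ℕ) (init : List ℕ) (qs : List Quad) (u : ℕ) : Bool :=
  Nat.beq (Nat.lor (overflow init (qs.map (Quad.at u))) (cond (Nat.beq u 0) 1 0)) (ones n)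

/-! ### The code and its reduced bases -/

/-- Rotates a number of `33` bits by `i` places. -/
def rotl (m i : ℕ) : ℕ := (m <<< i + m >>> (33 - i)) % 2 ^ 33

/-- The number whose bits are the residues modulo `33` of the elements of `l`. -/
def maskOf (l : List ℕ) : ℕ := (l.map fun i => 2 ^ (i % 33)).sum

/-- The support of the first row of `A`, with coordinates numbered from `0`. -/
def suppA : List ℕ :=
  [1, 2, 3, 4, 5, 7, 11, 12, 13, 15, 16, 17, 18, 20, 21, 22, 26, 28, 29, 30, 31, 32]

/-- The support of the first row of `B`, with coordinates numbered from `0`. -/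
def suppB : List ℕ := [2, 3, 4, 7, 9, 10, 11, 15, 19, 20, 24, 25, 27, 28, 29, 32]

/-- The rows of the generator matrix, in the encoding of `nz`. The list `suppB.map (33 - ·)` is the
support of the first column of `B`, that is of the first row of its transpose. -/
def gens : List ℕ :=
  ((List.range 33).map fun i =>
    2 ^ i + 2 ^ 66 * rotl (maskOf suppA) i + 2 ^ 99 * rotl (maskOf suppB) i) ++
  (List.range 33).map fun i =>
    2 ^ (33 + i) + 2 ^ 66 * rotl (maskOf (suppB.map (33 - ·))) i + 2 ^ 99 * rotl (maskOf suppA) i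

/-- The set of triples, numbered from `0` to `10`, whose bit in `m` is set. -/
def triples (m : ℕ) : List ℕ := (List.range 11).filter (tb m)

/-- The coordinates in the triples of `m`. Each half of the coordinates, starting at `off = 0` or
`off = 33`, consists of eleven triples, the cosets of the subgroup of order three of `ℤ / 33`. -/
def coords (off m : ℕ) : List ℕ :=
  (triples m).flatMap fun t => [off + t, off + t + 11, off + t + 22]

/-- The reduced basis of the code for a list `vs` of coordinates that contains an information set.
Nothing is assumed about this computation; `Job.check` verifies the result. -/
def pivots (vs : List ℕ) : List Pivot :=
  (pairUp vs.reverse (gauss (vs.flatMap fun v => [v, 66 + v]) [] gens)).reverse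

/-! ### The search -/

/-- A part of the search for words of weight less than `17`: those that are nonzero at no more than
`p + 1` of the left coordinates in the triples `L`, starting in the first position of a triple, and
at no more than `r` of the right coordinates in the triples `R`, where the combination of basis
words for the latter is in the chunk `i` of `128` combinations. -/
structure Job where
  L : ℕ
  p : ℕ
  R : ℕ
  r : ℕ
  i : ℕ

/-- Verifies that every codeword is the combination of the words of `us` determined by its values on
the coordinates of `L` and `R`, that the words belonging to `R` vanish on the coordinates of `L`,
which are the bits of `m`, and that there is no nonzero word as described at `Job`. The four bit
planes set initially are the number `15 = 32 - 17`, so that the counters overflow five bit planes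
when the weight reaches `17`. -/
def Job.check (J : Job) : Bool :=
  let lc := coords 0 J.L
  let m := (lc.map (2 ^ ·)).sum
  let us := pivots (lc ++ coords 33 J.R)
  let ul := us.take lc.length
  let ur := us.drop lc.length
  let s := (selector J.p (triples J.L).length).2
  let left := (List.range 66).filter (tb m)
  let rest := (List.range 66).filter fun v => !tb m v
  let init := addQuads (quads ul s left) [ones s.1, ones s.1, ones s.1, ones s.1, 0]
  gens.all (fun g => Nat.beq (combo g us) g) && us.map Pivot.pos == lc ++ coords 33 J.R &&
    ur.all (fun e => left.all fun v => !nz e.a v && !nz e.b v) &&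
    (((words ur J.r).drop (128 * J.i)).take 128).all (rejects s.1 init (quads ul s rest))

/-! ### Correctness of the bit columns -/

theorem tb_eq_testBit (w j : ℕ) : tb w j = w.testBit j := by
  change Nat.beq ((w >>> j) &&& 1) 1 = _
  rw [Nat.testBit, Nat.and_comm, Nat.one_and_eq_mod_two]
  rcases Nat.mod_two_eq_zero_or_one (w >>> j) with h | h <;> rw [h] <;> rfl

@[simp] theorem tb_zero (j : ℕ) : tb 0 j = false := by simp [tb_eq_testBit]

@[simp] theorem tb_xor (x y j : ℕ) : tb (x ^^^ y) j = (tb x j ^^ tb y j) := by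
  simp [tb_eq_testBit]

@[simp] theorem nz_zero (v : ℕ) : nz 0 v = false := by simp [nz]

/-- The number `c` is the column of the Boolean function `f` on the list `ws`: its bit `m` is the
value of `f` at the entry `m` of `ws`, and the bits beyond the list vanish. -/
def IsColumn {α : Type*} (ws : List α) (f : α → Bool) (c : ℕ) : Prop :=
  ∀ m, c.testBit m = (ws[m]?.map f).getD false

theorem testBit_ones (n m : ℕ) : (ones n).testBit m = decide (m < n) :=
  Nat.testBit_two_pow_sub_one n m

namespace IsColumn

variable {α β : Type*} {ws ws' : List α} {f g : α → Bool} {c d : ℕ}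

theorem zero (ws : List α) : IsColumn ws (fun _ => false) 0 := fun m => by
  cases ws[m]? <;> simp

theorem ones (ws : List α) : IsColumn ws (fun _ => true) (ones ws.length) := fun m => by
  rw [testBit_ones]
  by_cases h : m < ws.length
  · simp [h]
  · simp [h]

theorem xor (hc : IsColumn ws f c) (hd : IsColumn ws g d) :
    IsColumn ws (fun w => f w ^^ g w) (c ^^^ d) := fun m => by
  rw [Nat.testBit_xor, hc m, hd m]; cases ws[m]? <;> simp

theorem or (hc : IsColumn ws f c) (hd : IsColumn ws g d) :
    IsColumn ws (fun w => f w || g w) (c ||| d) := fun m => by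
  rw [Nat.testBit_or, hc m, hd m]; cases ws[m]? <;> simp

theorem not (hc : IsColumn ws f c) :
    IsColumn ws (fun w => !f w) (c ^^^ AdditiveCode.ones ws.length) := by
  simpa using hc.xor (ones ws)

theorem const (ws : List α) (b : Bool) :
    IsColumn ws (fun _ => b) (cond b (AdditiveCode.ones ws.length) 0) := by
  cases b
  · exact zero ws
  · exact ones ws

theorem map (h : β → α) {ws : List β} (hc : IsColumn ws (fun w => f (h w)) c) :
    IsColumn (ws.map h) f c := fun m => by
  rw [hc m, List.getElem?_map]; cases ws[m]? <;> simp

theorem append (hc : IsColumn ws f c) (hd : IsColumn ws' f d) :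
    IsColumn (ws ++ ws') f (c ^^^ d <<< ws.length) := fun m => by
  rw [Nat.testBit_xor, hc m, Nat.testBit_shiftLeft, hd]
  by_cases h : m < ws.length
  · rw [List.getElem?_append_left h]
    simp [Nat.not_le.2 h]
  · rw [List.getElem?_append_right (not_lt.1 h), List.getElem?_eq_none (not_lt.1 h)]
    simp [not_lt.1 h]

theorem congr (hc : IsColumn ws f c) (h : ∀ w, f w = g w) : IsColumn ws g c := by
  rwa [← funext h]

theorem testBit (hc : IsColumn ws f c) {m : ℕ} {w : α} (hw : ws[m]? = some w) :
    c.testBit m = f w := by rw [hc m, hw]; rfl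

end IsColumn

theorem options_column (e : Pivot) (j : ℕ) {ws : List ℕ} {c : ℕ}
    (hc : IsColumn ws (tb · j) c) :
    IsColumn (options e ws) (tb · j)
      ((cond (tb e.a j) (ones ws.length) 0 ^^^ c) ^^^
        ((cond (tb e.b j) (ones ws.length) 0 ^^^ c) ^^^
          (cond (tb e.a j ^^ tb e.b j) (ones ws.length) 0 ^^^ c) <<< ws.length) <<< ws.length) := by
  have key : ∀ x : ℕ, IsColumn (ws.map (x ^^^ ·)) (tb · j)
      (cond (tb x j) (ones ws.length) 0 ^^^ c) := fun x =>
    IsColumn.map _ (((IsColumn.const ws (tb x j)).xor hc).congr fun w => by simp)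
  have h := (key e.a).append ((key e.b).append (key (e.a ^^^ e.b)))
  simpa [options] using h

/-- The description `s` fits the lists `ws us` of words, for all `us` with `n` elements: its first
component is the length of the list, and `column` computes the bit columns of the list from the
second one. -/
def IsSelector (n : ℕ) (ws : List Pivot → List ℕ) (s : Sel) : Prop :=
  s.2.length = n ∧ ∀ us : List Pivot, us.length = n →
    s.1 = (ws us).length ∧ ∀ j, IsColumn (ws us) (tb · j) (column j us s.2)

theorem bit_mul (w j x : ℕ) : bit w j * x = cond (tb w j) x 0 := by
  have h : bit w j = 0 ∨ bit w j = 1 := by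
    have : bit w j = (w >>> j) % 2 := Nat.and_one_is_mod _
    omega
  rw [tb]
  rcases h with h | h <;> rw [h]
  · exact Nat.zero_mul x
  · exact Nat.one_mul x

theorem column_cons (j : ℕ) (e : Pivot) (us : List Pivot) (s : ℕ × ℕ) (ss : List (ℕ × ℕ)) :
    column j (e :: us) (s :: ss) =
      cond (tb e.a j) s.1 0 ^^^ (cond (tb e.b j) s.2 0 ^^^ column j us ss) := by
  rw [← bit_mul, ← bit_mul]
  rfl

theorem merge_xor (n m s t s' t' : ℕ) :
    merge n m s t ^^^ merge n m s' t' = merge n m (s ^^^ s') (t ^^^ t') := by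
  simp only [merge, Nat.shiftLeft_xor_distrib]
  ac_rfl

theorem merge_cond (n m : ℕ) (b : Bool) (s t : ℕ) :
    cond b (merge n m s t) 0 = merge n m (cond b s 0) (cond b t 0) := by
  cases b <;> simp [merge]

theorem column_mergeAll (n m j : ℕ) : ∀ (us : List Pivot) (ss ts : List (ℕ × ℕ)),
    ss.length = us.length → ts.length = us.length →
    column j us (mergeAll n m ss ts) = merge n m (column j us ss) (column j us ts)
  | [], _, _, _, _ => by simp [column, merge]
  | e :: us, s :: ss, t :: ts, hs, ht => by
    have ih := column_mergeAll n m j us ss ts (by simpa using hs) (by simpa using ht)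
    simp only [mergeAll, column_cons] at ih ⊢
    rw [ih, merge_cond, merge_cond, merge_xor, merge_xor]

theorem length_mergeAll (n m : ℕ) : ∀ ss ts : List (ℕ × ℕ), ss.length = ts.length →
    (mergeAll n m ss ts).length = ss.length
  | [], [], _ => rfl
  | s :: ss, t :: ts, h => by
    simpa [mergeAll] using length_mergeAll n m ss ts (by simpa using h)

theorem IsSelector.next {n : ℕ} {ws ws' : List Pivot → List ℕ} {x y : Sel}
    (hx : IsSelector n ws x) (hy : IsSelector n ws' y) {vs : List Pivot → List ℕ}
    (hvs : ∀ e us, us.length = n → vs (e :: us) = ws us ++ options e (ws' us)) :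
    IsSelector (n + 1) vs (nextSel x y) := by
  refine ⟨by simp [nextSel, length_mergeAll _ _ _ _ (hx.1.trans hy.1.symm), hx.1], ?_⟩
  rintro (_ | ⟨e, us⟩) hus
  · simp at hus
  replace hus : us.length = n := by simpa using hus
  obtain ⟨hx1, hxc⟩ := hx.2 us hus
  obtain ⟨hy1, hyc⟩ := hy.2 us hus
  rw [hvs e us hus]
  refine ⟨by simp [nextSel, options, hx1, hy1]; ring, fun j => ?_⟩
  have h := (hxc j).append (options_column e j (hyc j))
  rw [← hx1, ← hy1] at h
  convert h using 1
  simp only [nextSel, column_cons]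
  rw [column_mergeAll _ _ _ _ _ _ (hx.1.trans hus.symm) (hy.1.trans hus.symm)]
  generalize column j us x.2 = C
  generalize column j us y.2 = D
  cases tb e.a j <;> cases tb e.b j <;>
    simp only [merge, cond_true, cond_false, Nat.shiftLeft_xor_distrib, Bool.xor_self,
      Bool.xor_false, Bool.xor_true, Bool.not_false, Nat.xor_left_comm, Nat.xor_comm,
      Nat.xor_self, Nat.xor_zero]

theorem IsSelector.pad {n : ℕ} {ws vs : List Pivot → List ℕ} {x : Sel} (hx : IsSelector n ws x)
    (hvs : ∀ e us, us.length = n → vs (e :: us) = ws us) : IsSelector (n + 1) vs (padSel x) := by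
  refine ⟨by simp [padSel, hx.1], ?_⟩
  rintro (_ | ⟨e, us⟩) hus
  · simp at hus
  replace hus : us.length = n := by simpa using hus
  obtain ⟨hx1, hxc⟩ := hx.2 us hus
  rw [hvs e us hus]
  refine ⟨hx1, fun j => ?_⟩
  have : column j (e :: us) (padSel x).2 = column j us x.2 := by
    simp [padSel, column_cons]
  rw [this]; exact hxc j

/-- The entries of the table `l` fit the lists `words us q`, `words us (q + 1)`, … -/
def IsTable (n : ℕ) : ℕ → List Sel → Prop
  | _, [] => True
  | q, s :: l => IsSelector n (words · q) s ∧ IsTable n (q + 1) l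

theorem isTable_stepTail {n : ℕ} : ∀ {q : ℕ} {y : Sel} {l : List Sel},
    IsSelector n (words · q) y → IsTable n (q + 1) l → IsTable (n + 1) (q + 1) (stepTail y l)
  | _, _, [], _, _ => trivial
  | _, _, _ :: _, hy, hl =>
    ⟨hl.1.next hy fun _ _ _ => rfl, isTable_stepTail hl.1 hl.2⟩

theorem words_zero (us : List Pivot) : words us 0 = [0] := by cases us <;> rfl

theorem isTable_step {n : ℕ} : ∀ {l : List Sel}, IsTable n 0 l → IsTable (n + 1) 0 (step l)
  | [], _ => trivial
  | _ :: _, hl => ⟨hl.1.pad fun _ us _ => (words_zero us).symm,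
      isTable_stepTail hl.1 hl.2⟩

theorem IsTable.getD {n : ℕ} : ∀ {q : ℕ} {l : List Sel} (i : ℕ), IsTable n q l → i < l.length →
    IsSelector n (words · (q + i)) (l.getD i (0, []))
  | _, _ :: _, 0, h, _ => h.1
  | q, _ :: l, i + 1, h, hi => by
    have := h.2.getD i (by simpa using hi)
    rw [Nat.add_assoc, Nat.add_comm 1 i] at this
    simpa using this

theorem length_stepTail : ∀ (y : Sel) (l : List Sel), (stepTail y l).length = l.length
  | _, [] => rfl
  | _, x :: l => by simp [stepTail, length_stepTail x l]

theorem length_step : ∀ l : List Sel, (step l).length = l.length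
  | [] => rfl
  | x :: l => by simp [step, length_stepTail]

theorem isColumn_zero (j : ℕ) : IsColumn [0] (tb · j) 0 := fun m => by
  cases m <;> simp

theorem isTable_replicate (p q : ℕ) : IsTable 0 q (List.replicate p (1, [])) := by
  induction p generalizing q with
  | zero => trivial
  | succ p ih =>
    refine ⟨⟨rfl, fun us hus => ?_⟩, ih _⟩
    obtain rfl := List.length_eq_zero_iff.1 hus
    exact ⟨rfl, isColumn_zero⟩

theorem selector_spec (p k : ℕ) : (selector p k).1.length = p + 1 ∧
    IsTable (3 * k) 0 (selector p k).1 ∧ IsSelector (3 * k) (leadWords p) (selector p k).2 := by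
  induction k with
  | zero =>
    refine ⟨by simp [selector], isTable_replicate _ _, rfl, fun us hus => ?_⟩
    obtain rfl := List.length_eq_zero_iff.1 hus
    exact ⟨rfl, isColumn_zero⟩
  | succ k ih =>
    obtain ⟨hl, ht, hs⟩ := ih
    refine ⟨by simp [selector, tripleStep, length_step, hl],
      isTable_step (isTable_step (isTable_step ht)), ?_⟩
    have h2 := isTable_step (isTable_step ht)
    have h3 := h2.getD p (by simp [length_step, hl])
    rw [zero_add] at h3
    refine IsSelector.next (ws := fun us => leadWords p us.tail.tail)
      ((hs.pad (vs := fun us => leadWords p us.tail) fun _ _ _ => rfl).pad fun _ _ _ => rfl) h3 ?_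
    rintro e (_ | ⟨f, _ | ⟨g, us⟩⟩) hus
    · simp at hus
    · simp at hus
    · rfl

/-! ### Correctness of the counters -/

/-- The number in lane `m` of a list of bit planes, least significant first. -/
def laneValue (m : ℕ) : List ℕ → ℕ
  | [] => 0
  | p :: ps => (p.testBit m).toNat + 2 * laneValue m ps

/-- The number of entries of `xs` with bit `m` set. -/
def laneSum (m : ℕ) : List ℕ → ℕ
  | [] => 0
  | x :: xs => (x.testBit m).toNat + laneSum m xs

theorem laneValue_addBit (m : ℕ) : ∀ (ps : List ℕ) (b : ℕ),
    laneValue m (addBit ps b) = laneValue m ps + (b.testBit m).toNat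
  | [], b => by
    unfold addBit
    cases h : Nat.beq b 0
    · simp [laneValue]
    · obtain rfl := Nat.eq_of_beq_eq_true h
      simp [laneValue]
  | p :: ps, b => by
    unfold addBit
    cases h : Nat.beq b 0
    · have ih := laneValue_addBit m ps (p &&& b)
      rw [cond_false, laneValue, laneValue]
      change ((p ^^^ b).testBit m).toNat + 2 * laneValue m (addBit ps (p &&& b)) = _
      rw [ih, Nat.testBit_xor, Nat.testBit_and]
      cases p.testBit m <;> cases b.testBit m <;> simp <;> omega
    · obtain rfl := Nat.eq_of_beq_eq_true h
      simp [laneValue]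

/-- In every lane, the carries account for at most the sum of the columns. -/
theorem two_mul_laneSum_carries_le (m : ℕ) : ∀ (xs : List ℕ) (s : ℕ),
    2 * laneSum m (carries xs s) ≤ laneSum m xs + (s.testBit m).toNat
  | [], s => by simp [carries, laneSum]
  | [x], s => by
    change 2 * (((s &&& x).testBit m).toNat + 0) ≤ (x.testBit m).toNat + 0 + _
    rw [Nat.testBit_and]
    cases s.testBit m <;> cases x.testBit m <;> simp
  | x :: y :: l, s => by
    have ih := two_mul_laneSum_carries_le m l (s ^^^ (x ^^^ y))
    change 2 * (((x &&& y ||| s &&& (x ^^^ y)).testBit m).toNat +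
      laneSum m (carries l (s ^^^ (x ^^^ y)))) ≤
        (x.testBit m).toNat + ((y.testBit m).toNat + laneSum m l) + _
    simp only [Nat.testBit_xor, Nat.testBit_or, Nat.testBit_and] at ih ⊢
    revert ih
    cases s.testBit m <;> cases x.testBit m <;> cases y.testBit m <;> simp <;> omega

theorem one_le_laneSum_of_orAll {m : ℕ} : ∀ {xs : List ℕ}, (orAll xs).testBit m = true →
    1 ≤ laneSum m xs
  | [], h => by simp [orAll] at h
  | x :: xs, h => by
    change (x ||| orAll xs).testBit m = true at h
    rw [Nat.testBit_or, Bool.or_eq_true] at h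
    rcases h with h | h
    · simp [laneSum, h]
    · have := one_le_laneSum_of_orAll h
      simp only [laneSum]; omega

/-- Induction on the bit planes: the carries out of the lowest one are added to the others. -/
theorem le_of_overflow {m : ℕ} : ∀ {ps xs : List ℕ}, (overflow ps xs).testBit m = true →
    2 ^ ps.length ≤ laneValue m ps + laneSum m xs
  | [], xs, h => by simpa [laneValue] using one_le_laneSum_of_orAll h
  | p :: ps, xs, h => by
    have ih := le_of_overflow (ps := ps) (xs := carries xs p) h
    have := two_mul_laneSum_carries_le m xs p
    simp only [List.length_cons, laneValue, pow_succ]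
    omega

theorem nz_eq_false {w v : ℕ} : nz w v = false ↔ tb w v = false ∧ tb w (66 + v) = false :=
  Bool.or_eq_false_iff

theorem nz_eq_true {w v : ℕ} : nz w v = true ↔ tb w v = true ∨ tb w (66 + v) = true :=
  Bool.or_eq_true _ _ ▸ Iff.rfl

theorem nz_xor (w u v : ℕ) :
    nz (w ^^^ u) v = ((tb w v ^^ tb u v) || (tb w (66 + v) ^^ tb u (66 + v))) := by
  simp [nz]

theorem isColumn_at {ws : List ℕ} {v c d : ℕ} (hc : IsColumn ws (tb · v) c)
    (hd : IsColumn ws (tb · (66 + v)) d) (u : ℕ) :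
    IsColumn ws (fun w => nz (w ^^^ u) v) (Quad.at u (mkQuad v ws.length c d)) := by
  have e : Quad.at u (mkQuad v ws.length c d) =
      cond (tb u v) (cond (tb u (66 + v)) ((c ^^^ ones ws.length) ||| (d ^^^ ones ws.length))
        ((c ^^^ ones ws.length) ||| d)) (cond (tb u (66 + v)) (c ||| (d ^^^ ones ws.length))
          (c ||| d)) := rfl
  rw [e]
  simp only [nz_xor]
  cases tb u v <;> cases tb u (66 + v) <;> simp only [cond_true, cond_false, Bool.xor_false,
    Bool.xor_true]
  · exact hc.or hd
  · exact hc.or hd.not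
  · exact hc.not.or hd
  · exact hc.not.or hd.not

section
variable {n : ℕ} {ws : List Pivot → List ℕ} {s : Sel} {us : List Pivot}

theorem IsSelector.column_at (hs : IsSelector n ws s) (hus : us.length = n) (u v : ℕ) :
    IsColumn (ws us) (fun w => nz (w ^^^ u) v)
      (Quad.at u (mkQuad v s.1 (column v us s.2) (column (66 + v) us s.2))) := by
  obtain ⟨h1, h2⟩ := hs.2 us hus
  rw [h1]
  exact isColumn_at (h2 v) (h2 (66 + v)) u

theorem laneValue_addQuads (hs : IsSelector n ws s) (hus : us.length = n) {m w : ℕ}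
    (hw : (ws us)[m]? = some w) : ∀ (vs ps : List ℕ),
    laneValue m (addQuads (quads us s vs) ps) = laneValue m ps + vs.countP (nz w)
  | [], ps => by simp [quads, addQuads]
  | v :: vs, ps => by
    have ih := laneValue_addQuads hs hus hw vs
    simp only [quads, List.map_cons, addQuads] at ih ⊢
    rw [ih, laneValue_addBit, (hs.column_at hus 0 v).testBit hw, List.countP_cons, Nat.xor_zero]
    cases nz w v <;> simp
    omega

theorem laneSum_quads (hs : IsSelector n ws s) (hus : us.length = n) {m w : ℕ}
    (hw : (ws us)[m]? = some w) (u : ℕ) : ∀ vs : List ℕ,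
    laneSum m ((quads us s vs).map (Quad.at u)) = vs.countP (nz (w ^^^ u))
  | [] => by simp [quads, laneSum]
  | v :: vs => by
    have ih := laneSum_quads hs hus hw u vs
    simp only [quads, List.map_cons, laneSum] at ih ⊢
    rw [ih, (hs.column_at hus u v).testBit hw, List.countP_cons]
    cases nz (w ^^^ u) v <;> simp
    omega

theorem length_le_addBit : ∀ (ps : List ℕ) (b : ℕ), ps.length ≤ (addBit ps b).length
  | [], _ => Nat.zero_le _
  | p :: ps, b => by
    unfold addBit
    cases Nat.beq b 0
    · simpa using length_le_addBit ps _
    · exact le_rfl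

theorem length_le_addQuads : ∀ (qs : List Quad) (ps : List ℕ),
    ps.length ≤ (addQuads qs ps).length
  | [], _ => le_rfl
  | _ :: qs, ps => (length_le_addBit ps _).trans (length_le_addQuads qs _)

/-- The counters start at `15` plus the weight on `left`; if they overflow five bit planes when the
weight on `rest` is added, then the whole weight is at least `17`. -/
theorem le_of_rejects (hs : IsSelector n ws s) (hus : us.length = n) {m w u : ℕ}
    (hw : (ws us)[m]? = some w) {left rest : List ℕ}
    (hr : rejects s.1 (addQuads (quads us s left) [ones s.1, ones s.1, ones s.1, ones s.1, 0])
      (quads us s rest) u = true) (hmu : u = 0 → m ≠ 0) :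
    17 ≤ left.countP (nz w) + rest.countP (nz (w ^^^ u)) := by
  have hm : m < (ws us).length := (List.getElem?_eq_some_iff.1 hw).1
  have hn : s.1 = (ws us).length := (hs.2 us hus).1
  set init := addQuads (quads us s left) [ones s.1, ones s.1, ones s.1, ones s.1, 0]
    with hinit
  have hval : laneValue m init = 15 + left.countP (nz w) := by
    rw [hinit, laneValue_addQuads hs hus hw]
    simp [laneValue, testBit_ones, hn, hm]
  have hlen : 5 ≤ init.length := length_le_addQuads (quads us s left)
    [ones s.1, ones s.1, ones s.1, ones s.1, 0]
  have hbit := congrArg (Nat.testBit · m) (Nat.eq_of_beq_eq_true hr)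
  change (overflow init ((quads us s rest).map (Quad.at u)) ||| cond (Nat.beq u 0) 1 0).testBit m =
    (ones s.1).testBit m at hbit
  have hz : (cond (Nat.beq u 0) 1 0).testBit m = false := by
    cases hu : Nat.beq u 0
    · simp
    · obtain ⟨k, rfl⟩ := Nat.exists_eq_succ_of_ne_zero (hmu (Nat.eq_of_beq_eq_true hu))
      simp [Nat.testBit_succ]
  rw [Nat.testBit_or, hz, testBit_ones, hn, decide_eq_true hm, Bool.or_false] at hbit
  have := le_of_overflow hbit
  have h32 : 2 ^ 5 ≤ 2 ^ init.length := Nat.pow_le_pow_right (by norm_num) hlen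
  rw [hval, laneSum_quads hs hus hw] at this
  omega
end

/-! ### Expansion of codewords in a reduced basis -/

theorem part_def (W : ℕ) (e : Pivot) :
    part W e = cond (tb W e.pos) e.a 0 ^^^ cond (tb W (66 + e.pos)) e.b 0 := by
  rw [← bit_mul, ← bit_mul]
  rfl

theorem combo_cons (W : ℕ) (e : Pivot) (us : List Pivot) :
    combo W (e :: us) = part W e ^^^ combo W us := rfl

theorem part_eq_zero {W : ℕ} {e : Pivot} (h : nz W e.pos = false) : part W e = 0 := by
  rw [nz_eq_false] at h
  simp [part_def, h.1, h.2]

theorem part_xor_mem_options {W C : ℕ} {e : Pivot} {l : List ℕ} (h : nz W e.pos = true)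
    (hC : C ∈ l) : part W e ^^^ C ∈ options e l := by
  rw [nz_eq_true] at h
  simp only [part_def, options, List.mem_append, List.mem_map]
  revert h
  cases tb W e.pos <;> cases tb W (66 + e.pos) <;> intro h
  · simp at h
  · exact Or.inr (Or.inl ⟨C, hC, by simp⟩)
  · exact Or.inl ⟨C, hC, by simp⟩
  · exact Or.inr (Or.inr ⟨C, hC, by simp⟩)

theorem combo_mem_words (W : ℕ) : ∀ (us : List Pivot) (p : ℕ),
    us.countP (fun e => nz W e.pos) ≤ p → combo W us ∈ words us p
  | [], p, _ => by simp [combo, words]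
  | e :: us, p, h => by
    rw [List.countP_cons] at h
    rw [combo_cons]
    cases hz : nz W e.pos
    · rw [hz] at h
      have ih := combo_mem_words W us p (by simpa using h)
      rw [part_eq_zero hz, Nat.zero_xor]
      cases p with
      | zero => simpa [words_zero] using ih
      | succ p => exact List.mem_append_left _ ih
    · rw [hz] at h
      cases p with
      | zero => simp at h
      | succ p =>
        exact List.mem_append_right _ (part_xor_mem_options hz
          (combo_mem_words W us p (by simpa using h)))

/-- In a list of positions, grouped into triples, the first triple that meets the support
of `f` does so in its first position. -/
def Leads (f : ℕ → Bool) : List ℕ → Prop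
  | [] => True
  | v :: v' :: v'' :: vs => f v = true ∨
      (f v = false ∧ f v' = false ∧ f v'' = false ∧ Leads f vs)
  | _ => False

theorem combo_mem_leadWords (W p : ℕ) : ∀ us : List Pivot, Leads (nz W) (us.map Pivot.pos) →
    us.countP (fun e => nz W e.pos) ≤ p + 1 → combo W us ∈ leadWords p us
  | [], _, _ => by simp [combo, leadWords]
  | [_], h, _ => h.elim
  | [_, _], h, _ => h.elim
  | e :: f :: g :: us, h, hp => by
    rw [leadWords]
    rcases h with h | ⟨h1, h2, h3, h⟩
    · refine List.mem_append_right _ (part_xor_mem_options h (combo_mem_words W _ p ?_))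
      rw [List.countP_cons, h] at hp
      simpa using hp
    · have ih := combo_mem_leadWords W p us h (by simpa [List.countP_cons, h1, h2, h3] using hp)
      refine List.mem_append_left _ ?_
      rwa [combo_cons, combo_cons, combo_cons, part_eq_zero h1, part_eq_zero h2, part_eq_zero h3,
        Nat.zero_xor, Nat.zero_xor, Nat.zero_xor]

theorem words_getElem?_zero : ∀ (us : List Pivot) (p : ℕ), (words us p)[0]? = some 0
  | [], _ => rfl
  | _ :: _, 0 => rfl
  | e :: us, p + 1 => by
    have := words_getElem?_zero us (p + 1)
    rw [words, List.getElem?_append_left (List.getElem?_eq_some_iff.1 this).1, this]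

theorem leadWords_getElem?_zero (p : ℕ) : ∀ us : List Pivot, (leadWords p us)[0]? = some 0
  | [] => rfl
  | [_] => rfl
  | [_, _] => rfl
  | e :: f :: g :: us => by
    have := leadWords_getElem?_zero p us
    rw [leadWords, List.getElem?_append_left (List.getElem?_eq_some_iff.1 this).1, this]

theorem nz_eq_false_of_mem_words {v : ℕ} : ∀ {us : List Pivot} {p u : ℕ},
    (∀ e ∈ us, nz e.a v = false ∧ nz e.b v = false) → u ∈ words us p → nz u v = false
  | [], p, u, _, hu => by
    obtain rfl : u = 0 := by simpa [words] using hu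
    simp
  | _ :: _, 0, u, _, hu => by
    obtain rfl : u = 0 := by simpa [words] using hu
    simp
  | e :: us, p + 1, u, h, hu => by
    have h' : ∀ e ∈ us, nz e.a v = false ∧ nz e.b v = false := fun x hx => h x (by simp [hx])
    have he := h e (by simp)
    rw [words, options] at hu
    simp only [List.mem_append, List.mem_map] at hu
    rw [nz_eq_false, nz_eq_false] at he
    rcases hu with hu | ⟨x, hx, rfl⟩ | ⟨x, hx, rfl⟩ | ⟨x, hx, rfl⟩
    · exact nz_eq_false_of_mem_words h' hu
    all_goals
      have := nz_eq_false_of_mem_words h' hx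
      rw [nz_eq_false] at this ⊢
      simp [he, this]

/-- The length of `words us p` for a list `us` of `n` elements. -/
def numWords : ℕ → ℕ → ℕ
  | 0, _ => 1
  | _ + 1, 0 => 1
  | n + 1, p + 1 => numWords n (p + 1) + 3 * numWords n p

theorem length_words : ∀ (us : List Pivot) (p : ℕ),
    (words us p).length = numWords us.length p
  | [], _ => rfl
  | _ :: _, 0 => rfl
  | e :: us, p + 1 => by
    simp only [words, options, List.length_append, List.length_map, length_words us, numWords,
      List.length_cons]
    ring

/-- The sums of words of the list `l`. For `l = gens`, these encode the codewords. -/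
inductive XorSpan (l : List ℕ) : ℕ → Prop
  | zero : XorSpan l 0
  | xor {g w : ℕ} : g ∈ l → XorSpan l w → XorSpan l (g ^^^ w)

theorem combo_xor (x y : ℕ) : ∀ us : List Pivot,
    combo (x ^^^ y) us = combo x us ^^^ combo y us
  | [] => (Nat.xor_self _).symm
  | e :: us => by
    have hx : ∀ (b b' : Bool) (z : ℕ), cond (b ^^ b') z 0 = cond b z 0 ^^^ cond b' z 0 := by
      intro b b' z; cases b <;> cases b' <;> simp
    simp only [combo_cons, part_def, combo_xor x y us, tb_xor, hx]
    ac_rfl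

theorem combo_zero : ∀ us : List Pivot, combo 0 us = 0
  | [] => rfl
  | e :: us => by
    rw [combo_cons, combo_zero us, part_eq_zero (nz_zero _)]; rfl

theorem XorSpan.combo_eq {l : List ℕ} {us : List Pivot} (h : ∀ g ∈ l, combo g us = g) {W : ℕ}
    (hW : XorSpan l W) : combo W us = W := by
  induction hW with
  | zero => exact combo_zero us
  | xor hg _ ih => rw [combo_xor, h _ hg, ih]

theorem combo_append (W : ℕ) : ∀ us vs : List Pivot,
    combo W (us ++ vs) = combo W us ^^^ combo W vs
  | [], vs => (Nat.zero_xor _).symm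
  | e :: us, vs => by
    rw [List.cons_append, combo_cons, combo_cons, combo_append W us vs, Nat.xor_assoc]

/-! ### Correctness of the search -/

theorem length_coords (off m : ℕ) : (coords off m).length = 3 * (triples m).length := by
  simp [coords, List.length_flatMap, mul_comm]

theorem Job.check_spec {L p R r i : ℕ} (h : Job.check ⟨L, p, R, r, i⟩ = true) :
    (∀ g ∈ gens, combo g (pivots (coords 0 L ++ coords 33 R)) = g) ∧
    (pivots (coords 0 L ++ coords 33 R)).map Pivot.pos = coords 0 L ++ coords 33 R ∧
    (∀ e ∈ (pivots (coords 0 L ++ coords 33 R)).drop (coords 0 L).length, ∀ v < 66,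
      tb ((coords 0 L).map (2 ^ ·)).sum v = true → nz e.a v = false ∧ nz e.b v = false) := by
  simp only [Job.check, Bool.and_eq_true, List.all_eq_true, beq_iff_eq, List.mem_filter,
    List.mem_range, Bool.not_eq_true'] at h
  exact ⟨fun g hg => Nat.eq_of_beq_eq_true (h.1.1.1 g hg), h.1.1.2,
    fun e he v hv hvl => h.1.2 e he v ⟨hv, hvl⟩⟩

/-- If `w` and `u` are the parts of a nonzero codeword that belong to the left and right pivots of a
job, then the weight of the codeword is at least `17`. -/
theorem Job.weight_of_check {L p R r i : ℕ} (h : Job.check ⟨L, p, R, r, i⟩ = true) {w u m : ℕ}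
    (hw : (leadWords p ((pivots (coords 0 L ++ coords 33 R)).take (coords 0 L).length))[m]? = some w)
    (hu : u ∈ ((words ((pivots (coords 0 L ++ coords 33 R)).drop (coords 0 L).length) r).drop
      (128 * i)).take 128) (hmu : u = 0 → m ≠ 0) :
    17 ≤ (List.range 66).countP (nz (w ^^^ u)) := by
  obtain ⟨-, hpos, hvan⟩ := Job.check_spec h
  simp only [Job.check, Bool.and_eq_true] at h
  have hrej := List.all_eq_true.1 h.2 u hu
  have hlen : (List.take (coords 0 L).length (pivots (coords 0 L ++ coords 33 R))).length =
      3 * (triples L).length := by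
    have := congrArg List.length hpos
    simp only [List.length_map, List.length_append] at this
    rw [List.length_take, this, ← length_coords 0 L]
    omega
  have := le_of_rejects (selector_spec p (triples L).length).2.2 hlen hw hrej hmu
  rw [List.countP_eq_countP_filter_add _ _ fun v => tb ((coords 0 L).map (2 ^ ·)).sum v]
  refine this.trans_eq (congrArg₂ _ (List.countP_congr fun v hv => ?_) rfl)
  rw [List.mem_filter, List.mem_range] at hv
  have hz := nz_eq_false_of_mem_words (fun e he => hvan e he v hv.1 hv.2)
    (List.drop_subset _ _ (List.take_subset _ _ hu))
  rw [nz_eq_false] at hz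
  rw [nz_xor, hz.1, hz.2, Bool.xor_false, Bool.xor_false]
  rfl

/-- If all chunks of a job have been checked, then `0` is the only codeword of weight at most `16`
among those that the job is about. -/
theorem Job.eq_zero {L p R r : ℕ}
    (h : ∀ i < numWords (coords 33 R).length r / 128 + 1, Job.check ⟨L, p, R, r, i⟩ = true)
    {W : ℕ} (hW : XorSpan gens W) (hl : (coords 0 L).countP (nz W) ≤ p + 1)
    (hr : (coords 33 R).countP (nz W) ≤ r) (hlead : Leads (nz W) (coords 0 L))
    (h16 : (List.range 66).countP (nz W) ≤ 16) : W = 0 := by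
  obtain ⟨hcombo, hpos, -⟩ := Job.check_spec (h 0 (Nat.succ_pos _))
  set us := pivots (coords 0 L ++ coords 33 R) with hus
  set ul := us.take (coords 0 L).length with hul
  set ur := us.drop (coords 0 L).length with hur
  have hulpos : ul.map Pivot.pos = coords 0 L := by
    rw [hul, List.map_take, hpos, List.take_left]
  have hurpos : ur.map Pivot.pos = coords 33 R := by
    rw [hur, List.map_drop, hpos, List.drop_left]
  have hsum : combo W ul ^^^ combo W ur = W := by
    rw [← combo_append, hul, hur, List.take_append_drop, hW.combo_eq hcombo]
  have hwl : combo W ul ∈ leadWords p ul := by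
    refine combo_mem_leadWords W p ul (hulpos ▸ hlead) ?_
    rwa [← hulpos, List.countP_map] at hl
  have hwr : combo W ur ∈ words ur r := by
    refine combo_mem_words W ur r ?_
    rwa [← hurpos, List.countP_map] at hr
  obtain ⟨m, hm⟩ := List.mem_iff_getElem?.1 hwl
  obtain ⟨k, hk⟩ := List.mem_iff_getElem?.1 hwr
  have hk' : k < numWords (coords 33 R).length r := by
    have := (List.getElem?_eq_some_iff.1 hk).1
    rwa [length_words, ← List.length_map (f := Pivot.pos), hurpos] at this
  by_contra hne
  have hmu : combo W ur = 0 → m ≠ 0 := by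
    rintro h0 rfl
    rw [leadWords_getElem?_zero] at hm
    rw [h0, ← Option.some.inj hm] at hsum
    exact hne hsum.symm
  have hchunk : combo W ur ∈ ((words ur r).drop (128 * (k / 128))).take 128 := by
    refine List.mem_iff_getElem?.2 ⟨k % 128, ?_⟩
    rw [List.getElem?_take_of_lt (Nat.mod_lt _ (by norm_num)), List.getElem?_drop,
      Nat.div_add_mod, hk]
  have := Job.weight_of_check (h (k / 128) (Nat.lt_succ_of_le (Nat.div_le_div_right hk'.le)))
    hm hchunk hmu
  rw [hsum] at this
  omega

/-! ### Sets of triples with small weight -/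

/-- The sum of the entries of `ws` whose indices are bits of `m`. -/
def maskSum : ℕ → List ℕ → ℕ
  | _, [] => 0
  | m, x :: ws => cond (tb m 0) x 0 + maskSum (m / 2) ws

/-- The number with the digits `l` in base `64`, least significant first. -/
def pack : List ℕ → ℕ
  | [] => 0
  | d :: l => d + 64 * pack l

/-- Whether `t` has a digit in base `64` less than `32`, if `g` is the number of the same length
with all digits equal to `32`. -/
def hasSmallDigit (g t : ℕ) : Bool := !Nat.beq (Nat.land t g) g

/-- For each of `n` positions, the packed bits of the masks `ms` at this position, and the packed
flags of the masks with some bit from this position on. -/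
def maskTable : ℕ → List ℕ → List (ℕ × ℕ)
  | 0, _ => []
  | n + 1, ms => (pack (ms.map (· % 2)), pack (ms.map fun m => cond (Nat.beq m 0) 0 1)) ::
      maskTable n (ms.map (· / 2))

/-- The search behind `covers`, with the packed sums of the entries chosen so far in `t`. -/
def coverSearch (g : ℕ) : List (ℕ × ℕ) → ℕ → ℕ → Bool
  | [], _, t => hasSmallDigit g t
  | e :: es, b, t => hasSmallDigit g (Nat.add t (Nat.mul b e.2)) ||
      [0, 1, 2, 3].all fun x =>
        !Nat.ble x b || coverSearch g es (Nat.sub b x) (Nat.add t (Nat.mul x e.1))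

/-- Whether every list `ws` of `n` numbers, at most `3` each and with sum at most `b`, has
`maskSum e.1 ws ≤ e.2` for a pair `e` in the list `l`. All sums are computed in parallel: in base
`64` there is a digit for each `e`, which starts at `31 - e.2` and must stay below `32`. -/
def covers (n b : ℕ) (l : List (ℕ × ℕ)) : Bool :=
  Nat.ble b 32 && coverSearch (pack (l.map fun _ => 32)) (maskTable n (l.map Prod.fst)) b
    (pack (l.map fun e => 31 - e.2))

theorem maskSum_zero : ∀ ws : List ℕ, maskSum 0 ws = 0
  | [] => rfl
  | x :: ws => by simp [maskSum, maskSum_zero ws]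

theorem maskSum_le_sum : ∀ (m : ℕ) (ws : List ℕ), maskSum m ws ≤ ws.sum
  | _, [] => le_rfl
  | m, x :: ws => by
    have := maskSum_le_sum (m / 2) ws
    rw [maskSum, List.sum_cons]
    cases tb m 0 <;> simp only [cond_true, cond_false] <;> omega

theorem and_pack {a c P Q : ℕ} (ha : a < 64) (hc : c < 64) :
    (a + 64 * P) &&& (c + 64 * Q) = (a &&& c) + 64 * (P &&& Q) := by
  have hmod := Nat.and_mod_two_pow (a := a + 64 * P) (b := c + 64 * Q) (n := 6)
  have hdiv := Nat.and_div_two_pow (a := a + 64 * P) (b := c + 64 * Q) (n := 6)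
  norm_num at hmod hdiv
  rw [Nat.mod_eq_of_lt ha, Nat.mod_eq_of_lt hc] at hmod
  rw [show (a + 64 * P) / 64 = P by omega, show (c + 64 * Q) / 64 = Q by omega] at hdiv
  omega

theorem exists_of_hasSmallDigit {α : Type*} (d : α → ℕ) : ∀ {l : List α},
    (∀ e ∈ l, d e < 64) → hasSmallDigit (pack (l.map fun _ => 32)) (pack (l.map d)) = true →
      ∃ e ∈ l, d e < 32
  | [], _, h => by simp [hasSmallDigit, pack] at h
  | e :: l, hd, h => by
    by_cases he : d e < 32
    · exact ⟨e, List.mem_cons_self, he⟩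
    · have hlt := hd e List.mem_cons_self
      have h32 : d e &&& 32 = 32 := by
        have : ∀ x < 64, ¬ x < 32 → x &&& 32 = 32 := by decide
        exact this _ hlt he
      obtain ⟨e', he', h'⟩ := exists_of_hasSmallDigit d
        (fun x hx => hd x (List.mem_cons_of_mem _ hx)) (l := l) (by
          simp only [hasSmallDigit, Bool.not_eq_true', ← Bool.not_eq_true, Nat.beq_eq] at h ⊢
          refine fun h2 => h ?_
          change (d e + 64 * pack (l.map d)) &&& (32 + 64 * pack (l.map fun _ => 32)) = _
          rw [and_pack hlt (by norm_num), h32]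
          exact congrArg (fun x => 32 + 64 * x) h2)
      exact ⟨e', List.mem_cons_of_mem _ he', h'⟩

theorem pack_add_mul {α : Type*} (d f : α → ℕ) (x : ℕ) : ∀ l : List α,
    pack (l.map d) + x * pack (l.map f) = pack (l.map fun e => d e + x * f e)
  | [] => by simp [pack]
  | e :: l => by
    simp only [List.map_cons, pack, ← pack_add_mul d f x l]
    ring

theorem exists_of_coverSearch {α : Type*} {l : List α} : ∀ {n b : ℕ} (m d : α → ℕ) {ws : List ℕ},
    ws.length = n → (∀ x ∈ ws, x ≤ 3) → ws.sum ≤ b → (∀ e ∈ l, d e + b < 64) →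
    coverSearch (pack (l.map fun _ => 32)) (maskTable n (l.map m)) b (pack (l.map d)) = true →
      ∃ e ∈ l, d e + maskSum (m e) ws < 32
  | 0, b, m, d, ws, hn, _, _, hd, h => by
    obtain rfl := List.length_eq_zero_iff.1 hn
    exact exists_of_hasSmallDigit d (fun e he => by have := hd e he; omega) h
  | n + 1, b, m, d, [], hn, _, _, _, _ => by simp at hn
  | n + 1, b, m, d, x :: ws, hn, h3, hb, hd, h => by
    rw [maskTable, coverSearch, Bool.or_eq_true, List.map_map, List.map_map, List.map_map] at h
    rcases h with h | h
    · have h' : hasSmallDigit _ (pack (l.map d) + b * _) = true := h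
      rw [pack_add_mul] at h'
      obtain ⟨e, he, h⟩ := exists_of_hasSmallDigit _ (fun e he => by
        have := hd e he
        simp only [Function.comp]
        cases Nat.beq (m e) 0 <;> simp <;> omega) h'
      refine ⟨e, he, ?_⟩
      have hle := maskSum_le_sum (m e) (x :: ws)
      simp only [Function.comp] at h
      cases h0 : Nat.beq (m e) 0
      · rw [h0, cond_false] at h
        omega
      · rw [Nat.eq_of_beq_eq_true h0, maskSum_zero]
        rw [h0, cond_true] at h
        omega
    · rw [List.sum_cons] at hb
      have hx := List.all_eq_true.1 h x (by
        have := h3 x (by simp)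
        interval_cases x <;> simp)
      have hxb : Nat.ble x b = true := Nat.ble_eq_true_of_le (by omega)
      rw [hxb, Bool.not_true, Bool.false_or] at hx
      have h' : coverSearch _ _ (b - x) (pack (l.map d) + x * _) = true := hx
      rw [pack_add_mul] at h'
      obtain ⟨e, he, h⟩ := exists_of_coverSearch _ _ (ws := ws) (by simpa using hn)
        (fun y hy => h3 y (by simp [hy])) (by omega) (fun e he => by
          have := hd e he
          have h2 : m e % 2 ≤ 1 := by omega
          have := Nat.mul_le_mul_left x h2
          simp only [Function.comp]
          omega) h'
      refine ⟨e, he, ?_⟩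
      simp only [Function.comp] at h
      rw [maskSum]
      have hbit : tb (m e) 0 = decide (m e % 2 = 1) := by
        rw [tb_eq_testBit, Nat.testBit_zero]
      rw [hbit]
      rcases Nat.mod_two_eq_zero_or_one (m e) with h2 | h2 <;> simp [h2] at h ⊢ <;> omega

theorem exists_of_covers {n b : ℕ} {l : List (ℕ × ℕ)} {ws : List ℕ} (hn : ws.length = n)
    (h3 : ∀ x ∈ ws, x ≤ 3) (hb : ws.sum ≤ b) (h : covers n b l = true) :
    ∃ e ∈ l, maskSum e.1 ws ≤ e.2 := by
  rw [covers, Bool.and_eq_true] at h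
  have hb32 := Nat.le_of_ble_eq_true h.1
  obtain ⟨e, he, h⟩ := exists_of_coverSearch (l := l) _ _ hn h3 hb (fun e _ => by omega) h.2
  exact ⟨e, he, by omega⟩

/-- The weights of `f` on the eleven triples of one half of the coordinates. -/
def tripleWeights (f : ℕ → Bool) (off : ℕ) : List ℕ :=
  (List.range 11).map fun t => [off + t, off + t + 11, off + t + 22].countP f

theorem tripleWeights_le {f : ℕ → Bool} {off x : ℕ} (hx : x ∈ tripleWeights f off) : x ≤ 3 := by
  obtain ⟨t, -, rfl⟩ := List.mem_map.1 hx
  exact List.countP_le_length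

theorem maskSum_map_range' (g : ℕ → ℕ) (m : ℕ) : ∀ n a : ℕ,
    maskSum (m >>> a) ((List.range' a n).map g) = (((List.range' a n).filter (tb m)).map g).sum
  | 0, _ => rfl
  | n + 1, a => by
    have ih := maskSum_map_range' g m n (a + 1)
    have h0 : tb (m >>> a) 0 = tb m a := by simp [tb_eq_testBit]
    rw [List.range'_succ, List.map_cons, maskSum, ← Nat.shiftRight_succ, ih, h0,
      List.filter_cons]
    cases tb m a <;> simp

theorem maskSum_tripleWeights (f : ℕ → Bool) (off m : ℕ) :
    maskSum m (tripleWeights f off) = (coords off m).countP f := by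
  have := maskSum_map_range' (fun t => [off + t, off + t + 11, off + t + 22].countP f) m 11 0
  rw [Nat.shiftRight_zero, ← List.range_eq_range'] at this
  rw [tripleWeights, this, coords, triples, List.countP_flatMap]
  rfl

theorem sum_tripleWeights (f : ℕ → Bool) (off : ℕ) :
    (tripleWeights f off).sum = (coords off 2047).countP f := by
  rw [coords, List.countP_flatMap]
  rfl

/-! ### Symmetries of the code -/

/-- The permutation of the bits that rotates each block of `33` bits by `s`. It preserves the
encoding of words, with the coordinates permuted in the same way. -/
def rot (s v : ℕ) : ℕ := 33 * (v / 33) + (v % 33 + s) % 33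

/-- The permutation of the bits that exchanges the two halves of the coordinates and reverses both,
fixing the first place of a block of `33` bits. It preserves the encoding of words. -/
def swap (v : ℕ) : ℕ := 66 * (v / 66) + 33 * (1 - v % 66 / 33) + (33 - v % 33) % 33

theorem exists_xorSpan {π : ℕ → ℕ}
    (h : ∀ g ∈ gens, ∃ g' ∈ gens, ∀ v < 132, tb g' v = tb g (π v)) {W : ℕ}
    (hW : XorSpan gens W) : ∃ W', XorSpan gens W' ∧ ∀ v < 132, tb W' v = tb W (π v) := by
  induction hW with
  | zero => exact ⟨0, .zero, by simp⟩
  | @xor g w hg _ ih =>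
    obtain ⟨g', hg', hgv⟩ := h g hg
    obtain ⟨w', hw', hwv⟩ := ih
    exact ⟨g' ^^^ w', .xor hg' hw', fun v hv => by rw [tb_xor, tb_xor, hgv v hv, hwv v hv]⟩

theorem rot_symm : ∀ g ∈ gens, ∃ g' ∈ gens, ∀ v < 132,
    tb g' v = tb g (rot 1 v) := by
  have h : ∀ i < 66, (List.range 132).all (fun v =>
      tb (gens.getD (rot 32 i) 0) v ==
        tb (gens.getD i 0) (rot 1 v)) = true := by decide +kernel
  have hl : gens.length = 66 := by simp [gens]
  intro g hg
  obtain ⟨i, hi, rfl⟩ := List.getElem_of_mem hg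
  have hj : rot 32 i < gens.length := by unfold rot; omega
  refine ⟨_, List.getElem_mem hj, fun v hv => ?_⟩
  have := List.all_eq_true.1 (h i (by omega)) v (List.mem_range.2 hv)
  rwa [List.getD_eq_getElem _ _ hi, List.getD_eq_getElem _ _ hj, beq_iff_eq] at this

theorem swap_symm : ∀ g ∈ gens, ∃ g' ∈ gens, ∀ v < 132,
    tb g' v = tb g (swap v) := by
  have h : ∀ i < 66, (List.range 132).all (fun v =>
      tb (gens.getD (swap i) 0) v ==
        tb (gens.getD i 0) (swap v)) =
          true := by decide +kernel
  have hl : gens.length = 66 := by simp [gens]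
  intro g hg
  obtain ⟨i, hi, rfl⟩ := List.getElem_of_mem hg
  have hj : swap i < gens.length := by unfold swap; omega
  refine ⟨_, List.getElem_mem hj, fun v hv => ?_⟩
  have := List.all_eq_true.1 (h i (by omega)) v (List.mem_range.2 hv)
  rwa [List.getD_eq_getElem _ _ hi, List.getD_eq_getElem _ _ hj, beq_iff_eq] at this

theorem exists_rot_one {W : ℕ} (hW : XorSpan gens W) : ∃ W', XorSpan gens W' ∧
    ∀ v < 66, nz W' v = nz W (rot 1 v) := by
  obtain ⟨W', h', h⟩ := exists_xorSpan rot_symm hW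
  refine ⟨W', h', fun v hv => ?_⟩
  have e : rot 1 (66 + v) = 66 + rot 1 v := by unfold rot; omega
  have h2 := h (66 + v) (by omega)
  rw [e] at h2
  exact congrArg₂ or (h v (by omega)) h2

theorem exists_swap {W : ℕ} (hW : XorSpan gens W) : ∃ W', XorSpan gens W' ∧
    ∀ v < 66, nz W' v = nz W (swap v) := by
  obtain ⟨W', h', h⟩ := exists_xorSpan swap_symm hW
  refine ⟨W', h', fun v hv => ?_⟩
  have e : swap (66 + v) = 66 + swap v := by unfold swap; omega
  have h2 := h (66 + v) (by omega)
  rw [e] at h2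
  exact congrArg₂ or (h v (by omega)) h2

theorem exists_rot {W : ℕ} (hW : XorSpan gens W) (s : ℕ) : ∃ W', XorSpan gens W' ∧
    ∀ v < 66, nz W' v = nz W (rot s v) := by
  induction s with
  | zero => exact ⟨W, hW, fun v hv => congrArg _ (by unfold rot; omega)⟩
  | succ s ih =>
    obtain ⟨W', h', h⟩ := ih
    obtain ⟨W'', h'', h2⟩ := exists_rot_one h'
    refine ⟨W'', h'', fun v hv => ?_⟩
    rw [h2 v hv, h _ (by unfold rot; omega)]
    congr 1
    unfold rot
    omega

theorem countP_of_perm {f g : ℕ → Bool} {π : ℕ → ℕ} (h : ∀ v < 66, f v = g (π v)) {l l' : List ℕ}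
    (hl : ∀ v ∈ l, v < 66) (hp : (l.map π).Perm l') : l.countP f = l'.countP g := by
  rw [← hp.countP_eq, List.countP_map]
  exact List.countP_congr fun v hv => by rw [h v (hl v hv)]; rfl

theorem mem_triples {m t : ℕ} (h : t ∈ triples m) : t < 11 :=
  List.mem_range.1 (List.mem_of_mem_filter h)

theorem lt_of_mem_coords {off m v : ℕ} (h : v ∈ coords off m) : v < off + 33 := by
  simp only [coords, List.mem_flatMap, List.mem_cons, List.not_mem_nil, or_false] at h
  obtain ⟨t, ht, h⟩ := h
  have := mem_triples ht
  omega

/-- Rotations by multiples of `11` permute every triple. -/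
theorem coords_rot_perm (m h : ℕ) : ((coords 0 m).map (rot (11 * h))).Perm (coords 0 m) := by
  rw [coords, List.map_flatMap]
  refine List.Perm.flatMap_left _ fun t ht => ?_
  have key : ∀ t < 11, ∀ h < 3, ([0 + t, 0 + t + 11, 0 + t + 22].map (rot (11 * h))).Perm
      [0 + t, 0 + t + 11, 0 + t + 22] := by decide
  have e : rot (11 * h) = rot (11 * (h % 3)) := by
    funext v
    unfold rot
    omega
  rw [e]
  exact key t (mem_triples ht) _ (Nat.mod_lt _ (by norm_num))

/-- The first triple in `ts` that meets the support of `f` can be made to do so in its first position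
by a rotation that preserves all triples. -/
theorem exists_leads (f : ℕ → Bool) : ∀ ts : List ℕ, (∀ t ∈ ts, t < 11) →
    ∃ h < 3, ∀ g : ℕ → Bool, (∀ v < 66, g v = f (rot (11 * h) v)) →
      Leads g (ts.flatMap fun t => [0 + t, 0 + t + 11, 0 + t + 22])
  | [], _ => ⟨0, by norm_num, fun _ _ => trivial⟩
  | t :: ts, ht => by
    have ht' : t < 11 := ht t (by simp)
    by_cases hz : ∃ h < 3, f (t + 11 * h) = true
    · obtain ⟨h, hh, hf⟩ := hz
      refine ⟨h, hh, fun g hg => Or.inl ?_⟩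
      rw [hg _ (by omega), ← hf]
      congr 1
      unfold rot
      omega
    · have hz' : ∀ v, v % 11 = t → v < 33 → f v = false := fun v hv hv' => by
        refine Bool.eq_false_iff.2 fun hf => hz ⟨v / 11, by omega, ?_⟩
        rwa [show t + 11 * (v / 11) = v by omega]
      obtain ⟨h, hh, ih⟩ := exists_leads f ts fun x hx => ht x (by simp [hx])
      refine ⟨h, hh, fun g hg => Or.inr ⟨?_, ?_, ?_, ih g hg⟩⟩ <;>
      · rw [hg _ (by omega)]
        exact hz' _ (by unfold rot; omega) (by unfold rot; omega)

theorem half_rot_perm : ∀ s < 33, ((List.range 33).map (rot s)).Perm (List.range 33) ∧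
    ((List.range' 33 33).map (rot s)).Perm (List.range' 33 33) := by decide +kernel

theorem half_swap_perm : ((List.range 33).map swap).Perm (List.range' 33 33) ∧
    ((List.range' 33 33).map swap).Perm (List.range 33) := by decide +kernel

/-! ### Reduction to the search -/

/-- Rotates a set of triples by `s`. -/
def rotMask (m s : ℕ) : ℕ := (m <<< s + m >>> (11 - s)) % 2 ^ 11

/-- The words with weight at most `a` on the left half of the coordinates and at most `b` on the right
half. Each has, after a rotation, weight at most `p + 1` on the triples in `L`, and weight at most
`e.2` on the triples in `e.1` for some pair `e` in the list `R`. -/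
structure Case where
  a : ℕ
  b : ℕ
  L : ℕ
  p : ℕ
  R : List (ℕ × ℕ)

/-- The searches that exclude the words of a case. -/
def Case.jobs (P : Case) : List Job :=
  P.R.flatMap fun e => (List.range (numWords (coords 33 e.1).length e.2 / 128 + 1)).map
    fun i => ⟨P.L, P.p, e.1, e.2, i⟩

/-- Verifies the claim made at `Case`. The rotations of the left half by `0, …, 10` act on its
triples as all rotations do. -/
def Case.covered (P : Case) : Bool :=
  covers 11 P.a ((List.range 11).map fun s => (rotMask P.L s, P.p + 1)) && covers 11 P.b P.R &&
    (List.range 11).all fun s => ((coords 0 P.L).map (rot s)).isPerm (coords 0 (rotMask P.L s))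

theorem range_66 : List.range 66 = List.range 33 ++ List.range' 33 33 := by decide

theorem coords_perm : (coords 0 2047).Perm (List.range 33) ∧
    (coords 33 2047).Perm (List.range' 33 33) := by decide +kernel

theorem lt_range {v : ℕ} (hv : v ∈ List.range 33) : v < 66 := by
  have := List.mem_range.1 hv
  omega

theorem lt_range' {v : ℕ} (hv : v ∈ List.range' 33 33) : v < 66 := by
  have := (List.mem_range'_1.1 hv).2
  omega

/-- The words of weight at most `16` in a case vanish, if all its searches have been carried out. -/
theorem Case.countP_eq_zero {P : Case} (hc : P.covered = true)
    (hjobs : ∀ J ∈ P.jobs, J.check = true) {W : ℕ} (hW : XorSpan gens W)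
    (hl : (List.range 33).countP (nz W) ≤ P.a) (hr : (List.range' 33 33).countP (nz W) ≤ P.b)
    (h16 : (List.range 33).countP (nz W) + (List.range' 33 33).countP (nz W) ≤ 16) :
    (List.range 33).countP (nz W) + (List.range' 33 33).countP (nz W) = 0 := by
  simp only [Case.covered, Bool.and_eq_true, List.all_eq_true, List.mem_range,
    List.isPerm_iff] at hc
  obtain ⟨⟨hcl, hcr⟩, hperm⟩ := hc
  have half : ∀ {W W' : ℕ} {s : ℕ}, s < 33 → (∀ v < 66, nz W' v = nz W (rot s v)) →
      (List.range 33).countP (nz W') = (List.range 33).countP (nz W) ∧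
      (List.range' 33 33).countP (nz W') = (List.range' 33 33).countP (nz W) := fun hs h =>
    ⟨countP_of_perm h (fun _ => lt_range) (half_rot_perm _ hs).1,
      countP_of_perm h (fun _ => lt_range') (half_rot_perm _ hs).2⟩
  -- A first rotation makes the weight on `P.L` small.
  obtain ⟨e, he, hle⟩ := exists_of_covers (ws := tripleWeights (nz W) 0) (by simp [tripleWeights])
    (fun _ => tripleWeights_le) (by rwa [sum_tripleWeights, coords_perm.1.countP_eq]) hcl
  obtain ⟨s, hs, rfl⟩ := List.mem_map.1 he
  rw [List.mem_range] at hs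
  obtain ⟨W₁, hW₁, h₁⟩ := exists_rot hW s
  have hL₁ : (coords 0 P.L).countP (nz W₁) ≤ P.p + 1 := by
    rw [countP_of_perm h₁ (fun v hv => (lt_of_mem_coords hv).trans (by norm_num)) (hperm s hs),
      ← maskSum_tripleWeights]
    exact hle
  obtain ⟨hl₁, hr₁⟩ := half (by omega) h₁
  -- A second one makes it start in the first position of a triple.
  obtain ⟨h, hh, hlead⟩ := exists_leads (nz W₁) (triples P.L) fun _ => mem_triples
  obtain ⟨W₂, hW₂, h₂⟩ := exists_rot hW₁ (11 * h)
  have hL₂ : (coords 0 P.L).countP (nz W₂) ≤ P.p + 1 := by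
    rwa [countP_of_perm h₂ (fun v hv => (lt_of_mem_coords hv).trans (by norm_num))
      (coords_rot_perm _ h)]
  obtain ⟨hl₂, hr₂⟩ := half (by omega) h₂
  rw [hl₁] at hl₂
  rw [hr₁] at hr₂
  obtain ⟨⟨R, r⟩, hRr, hR⟩ := exists_of_covers (ws := tripleWeights (nz W₂) 33)
    (by simp [tripleWeights]) (fun _ => tripleWeights_le)
    (by rwa [sum_tripleWeights, coords_perm.2.countP_eq, hr₂]) hcr
  rw [maskSum_tripleWeights] at hR
  have h0 : W₂ = 0 := by
    refine Job.eq_zero (fun i hi => hjobs _ ?_) hW₂ hL₂ hR (hlead _ h₂) ?_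
    · exact List.mem_flatMap.2 ⟨_, hRr, List.mem_map.2 ⟨i, List.mem_range.2 hi, rfl⟩⟩
    · rwa [range_66, List.countP_append, hl₂, hr₂]
  rw [← hl₂, ← hr₂, h0]
  simp [List.countP_eq_zero]

/-! ### The cases

The sets of triples were found by a computer search. For each pair of `L` and `R` the coordinates
contain an information set; for this reason some of the sets `R` are larger than it takes to have
`33` coordinates.
-/

/-- Left weight at most `8`, right weight at most `8`. -/
def case8 : Case where
  a := 8
  b := 8
  L := 699
  p := 3
  R := [(1098, 2), (792, 2), (39, 2), (1440, 1), (1632, 1), (897, 1), (156, 1), (1300, 1),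
    (1217, 1), (708, 1), (1192, 1), (1170, 1), (452, 1), (676, 1), (1410, 1), (1080, 1),
    (1105, 1), (278, 1), (650, 1), (240, 1), (525, 1), (329, 1), (153, 1), (1793, 1), (579, 1),
    (1108, 1), (360, 1), (1668, 1)]

/-- Left weight at most `7`, right weight at most `9`. -/
def case7 : Case where
  a := 7
  b := 9
  L := 447
  p := 3
  R := [(134, 2), (1568, 2), (73, 1), (274, 1), (21, 1), (328, 1), (88, 1), (385, 1)]

/-- Left weight at most `6`, right weight at most `10`. -/
def case6 : Case where
  a := 6
  b := 10
  L := 511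
  p := 3
  R := [(41, 2), (576, 1), (6, 1), (144, 1), (1280, 1)]

/-- Left weight at most `5`, right weight at most `11`. -/
def case5 : Case where
  a := 5
  b := 11
  L := 1023
  p := 3
  R := [(1536, 1), (384, 1), (80, 1), (36, 1), (10, 1), (1, 1)]

/-- Left weight at most `4`; the right weight is not restricted. -/
def case4 : Case where
  a := 4
  b := 16
  L := 1023
  p := 2
  R := [(288, 2), (1536, 2), (6, 2), (80, 2), (136, 2), (1, 1)]

theorem case8_covered : case8.covered = true := by decide +kernel
theorem case7_covered : case7.covered = true := by decide +kernel
theorem case6_covered : case6.covered = true := by decide +kernel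
theorem case5_covered : case5.covered = true := by decide +kernel
theorem case4_covered : case4.covered = true := by decide +kernel

/-- Reduces the search to separate evaluations, which bounds the memory that is in use at a time. -/
theorem forall_mem_of_getD {P : Case} {n : ℕ} (hn : P.jobs.length = n)
    (h : ∀ k < n, (P.jobs.getD k ⟨0, 0, 0, 0, 0⟩).check = true) :
    ∀ J ∈ P.jobs, J.check = true := by
  subst hn
  intro J hJ
  obtain ⟨k, hk, rfl⟩ := List.getElem_of_mem hJ
  rw [← List.getD_eq_getElem P.jobs ⟨0, 0, 0, 0, 0⟩ hk]
  exact h k hk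

set_option maxHeartbeats 2000000 in
theorem case8_checked : ∀ J ∈ case8.jobs, J.check = true :=
  forall_mem_of_getD (n := 40) (by decide +kernel) fun k hk => by
    interval_cases k <;> decide +kernel

theorem case7_checked : ∀ J ∈ case7.jobs, J.check = true :=
  forall_mem_of_getD (n := 12) (by decide +kernel) fun k hk => by
    interval_cases k <;> decide +kernel

theorem case6_checked : ∀ J ∈ case6.jobs, J.check = true :=
  forall_mem_of_getD (n := 7) (by decide +kernel) fun k hk => by
    interval_cases k <;> decide +kernel

theorem case5_checked : ∀ J ∈ case5.jobs, J.check = true :=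
  forall_mem_of_getD (n := 6) (by decide +kernel) fun k hk => by
    interval_cases k <;> decide +kernel

theorem case4_checked : ∀ J ∈ case4.jobs, J.check = true :=
  forall_mem_of_getD (n := 11) (by decide +kernel) fun k hk => by
    interval_cases k <;> decide +kernel

/-! ### The field with four elements -/

theorem two_eq_zero_of_card {F : Type*} [Field F] [Fintype F] (hF : Fintype.card F = 4) :
    (2 : F) = 0 := by
  have h : ((Fintype.card F : ℕ) : F) = 0 := Nat.cast_card_eq_zero F
  rw [hF] at h
  have h4 : (2 : F) * 2 = 0 := by
    push_cast at h
    linear_combination h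
  exact mul_self_eq_zero.1 h4

/-- The element `a + b * ω`, for bits `a` and `b`. -/
def ofBits {F : Type*} [Field F] (ω : F) (a b : Bool) : F := cond a 1 0 + ω * cond b 1 0

section
variable {F : Type*} [Field F] {ω : F}

theorem ofBits_eq_zero (h2 : (2 : F) = 0) (hω : ω ^ 2 = ω + 1) {a b : Bool} :
    ofBits ω a b = 0 ↔ (a || b) = false := by
  have h0 : ω ≠ 0 := by
    rintro rfl
    norm_num at hω
  have h1 : 1 + ω ≠ 0 := fun h => one_ne_zero (α := F) (by linear_combination -hω + ω * h - h2 * ω)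
  cases a <;> cases b <;> simp [ofBits, h0, h1]

theorem ofBits_xor (h2 : (2 : F) = 0) (a b a' b' : Bool) :
    ofBits ω (a ^^ a') (b ^^ b') = ofBits ω a b + ofBits ω a' b' := by
  cases a <;> cases b <;> cases a' <;> cases b' <;> simp [ofBits] <;>
    first | ring1 | linear_combination -h2 | linear_combination -h2 * ω |
      linear_combination -h2 * ω - h2

theorem exists_ofBits [Fintype F] (hF : Fintype.card F = 4) (hω : ω ^ 2 = ω + 1) (x : F) :
    ∃ a b, x = ofBits ω a b := by
  have h2 := two_eq_zero_of_card hF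
  have hinj : Function.Injective fun p : Bool × Bool => ofBits ω p.1 p.2 := by
    rintro ⟨a, b⟩ ⟨a', b'⟩ h
    have h : ofBits ω a b = ofBits ω a' b' := h
    have h0 : ofBits ω (a ^^ a') (b ^^ b') = 0 := by
      rw [ofBits_xor h2, h]
      linear_combination h2 * ofBits ω a' b'
    rw [ofBits_eq_zero h2 hω, Bool.or_eq_false_iff] at h0
    simpa using h0
  have hcard : Fintype.card (Bool × Bool) = Fintype.card F := by rw [hF]; rfl
  obtain ⟨⟨a, b⟩, h⟩ := ((Fintype.bijective_iff_injective_and_card _).2 ⟨hinj, hcard⟩).2 x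
  exact ⟨a, b, h.symm⟩

/-! ### Self-duality -/

variable {n : ℕ}

theorem traceInner_comm (x y : Fin n → F) : traceInner x y = traceInner y x :=
  Finset.sum_congr rfl fun i _ => by ring

theorem traceInner_add (h2 : (2 : F) = 0) (x x' y : Fin n → F) :
    traceInner (x + x') y = traceInner x y + traceInner x' y := by
  rw [traceInner, traceInner, traceInner, ← Finset.sum_add_distrib]
  refine Finset.sum_congr rfl fun i _ => ?_
  rw [Pi.add_apply]
  linear_combination x i * x' i * y i * h2

theorem traceInner_eq_zero_of_mem_closure (h2 : (2 : F) = 0) {S : Set (Fin n → F)}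
    {y : Fin n → F} (h : ∀ x ∈ S, traceInner x y = 0) {x : Fin n → F}
    (hx : x ∈ AddSubgroup.closure S) : traceInner x y = 0 := by
  induction hx using AddSubgroup.closure_induction with
  | mem x hx => exact h x hx
  | zero => simp [traceInner]
  | add x x' _ _ ih ih' => rw [traceInner_add h2, ih, ih', add_zero]
  | neg x _ ih =>
    have : -x = x := funext fun i => by rw [Pi.neg_apply]; linear_combination -(x i) * h2
    rwa [this]

/-- A vector is `u + ω v` for vectors `u` and `v` over the prime field, and its trace inner
products with the rows of `M + ω I` are the coordinates of `u + M v`. -/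
theorem traceInner_row (h2 : (2 : F) = 0) (hω : ω ^ 2 = ω + 1) {M : Matrix (Fin n) (Fin n) F}
    (hM : ∀ i j, M i j ^ 2 = M i j) {u v : Fin n → F} (hu : ∀ i, u i ^ 2 = u i)
    (hv : ∀ i, v i ^ 2 = v i) (i : Fin n) :
    traceInner (u + ω • v) ((M + ω • (1 : Matrix (Fin n) (Fin n) F)) i) = u i + (M *ᵥ v) i := by
  have key : ∀ j, (u + ω • v) j * (M + ω • (1 : Matrix (Fin n) (Fin n) F)) i j ^ 2 +
      (u + ω • v) j ^ 2 * (M + ω • (1 : Matrix (Fin n) (Fin n) F)) i j =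
        (if i = j then u j else 0) + M i j * v j := by
    intro j
    simp only [Pi.add_apply, Pi.smul_apply, Matrix.add_apply, Matrix.smul_apply,
      Matrix.one_apply, smul_eq_mul]
    have hM := hM i j
    have hu := hu j
    have hv := hv j
    split_ifs
    · linear_combination (u j + ω * v j) * hM + (M i j + ω) * hu + ω ^ 2 * (M i j + ω) * hv +
        (u j + v j * M i j) * hω + (u j * M i j + u j * ω + v j * M i j * ω + ω ^ 3 * v j +
          M i j * ω * (u j + ω * v j) + u j * v j * ω * (M i j + ω)) * h2
    · linear_combination (u j + ω * v j) * hM + M i j * hu + ω ^ 2 * M i j * hv +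
        v j * M i j * hω + (u j * M i j + ω * v j * M i j + u j * v j * ω * M i j) * h2
  rw [traceInner, Finset.sum_congr rfl fun j _ => key j, Finset.sum_add_distrib,
    Finset.sum_ite_eq]
  simp [Matrix.mulVec, dotProduct]

theorem row_eq (M : Matrix (Fin n) (Fin n) F) (i : Fin n) :
    (M + ω • (1 : Matrix (Fin n) (Fin n) F)) i = M i + ω • (Pi.single i 1 : Fin n → F) := by
  funext j
  simp [Matrix.one_apply, Pi.single_apply, eq_comm]

/-- Over the field with four elements, `M + ω I` generates a self-dual code for every symmetric
matrix `M` over the prime field. -/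
theorem isSelfDual_rowCode [Fintype F] (hF : Fintype.card F = 4) (hω : ω ^ 2 = ω + 1)
    {M : Matrix (Fin n) (Fin n) F} (hM : ∀ i j, M i j ^ 2 = M i j) (hs : M.IsSymm) :
    IsSelfDual (rowCode (M + ω • (1 : Matrix (Fin n) (Fin n) F))) := by
  have h2 := two_eq_zero_of_card hF
  ext x
  constructor
  · intro hx y hy
    refine traceInner_eq_zero_of_mem_closure h2 ?_ hx
    rintro _ ⟨i, rfl⟩
    rw [traceInner_comm]
    refine traceInner_eq_zero_of_mem_closure h2 ?_ hy
    rintro _ ⟨k, rfl⟩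
    simp only
    rw [row_eq M k, traceInner_row h2 hω hM (hM k) (fun j => by
      by_cases h : j = k <;> simp [h]), Matrix.mulVec_single_one]
    have := hs.apply i k
    simp only [Matrix.col_apply]
    linear_combination M k i * h2 - this
  · intro hx
    choose a b hab using fun i => exists_ofBits hF hω (x i)
    set u : Fin n → F := fun i => cond (a i) 1 0 with hu
    set v : Fin n → F := fun i => cond (b i) 1 0 with hv
    have hx' : x = u + ω • v := funext fun i => hab i
    have huv : u = M *ᵥ v := by
      funext i
      have h0 := hx _ (AddSubgroup.subset_closure ⟨i, rfl⟩)
      rw [hx', traceInner_row h2 hω hM (fun j => by cases h : a j <;> simp [hu, h])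
        (fun j => by cases h : b j <;> simp [hv, h])] at h0
      linear_combination h0 - (M *ᵥ v) i * h2
    have hsum : x = ∑ i, v i • (M + ω • (1 : Matrix (Fin n) (Fin n) F)) i := by
      rw [hx', huv]
      funext j
      rw [Finset.sum_apply]
      simp only [Pi.smul_apply, Matrix.add_apply, Matrix.smul_apply, smul_eq_mul, mul_add,
        Finset.sum_add_distrib, Pi.add_apply, Matrix.mulVec, dotProduct, Matrix.one_apply,
        mul_ite, mul_one, mul_zero, Finset.sum_ite_eq', Finset.mem_univ, if_true]
      congr 1
      · exact Finset.sum_congr rfl fun i _ => by rw [hs.apply, mul_comm]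
      · ring
    rw [hsum]
    refine AddSubgroup.sum_mem _ fun i _ => ?_
    cases h : b i
    · simp [hv, h]
    · rw [show v i = 1 by simp [hv, h], one_smul]
      exact AddSubgroup.subset_closure ⟨i, rfl⟩

end

/-! ### The code of length 66 -/

section
variable (F : Type*) [Field F]

theorem A66_apply (i j : Fin 33) : A66 F i j =
    cond (tb (gens.getD i 0) (66 + j)) 1 0 := by
  have h : ∀ i j : Fin 33, tb (gens.getD i 0) (66 + j) = decide (((j - i : Fin 33) : ℕ) + 1 ∈
      ({2, 3, 4, 5, 6, 8, 12, 13, 14, 16, 17, 18, 19, 21, 22, 23, 27, 29, 30, 31, 32, 33} :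
        Finset ℕ)) := by decide +kernel
  rw [h, A66, circulantOfFirstRow, Matrix.transpose_apply, Matrix.circulant_apply,
    vectorOfSupport, Bool.cond_decide]

theorem A66_apply' (i j : Fin 33) : A66 F i j =
    cond (tb (gens.getD (33 + i) 0) (66 + (33 + j))) 1 0 := by
  have h : ∀ i j : Fin 33, tb (gens.getD (33 + i) 0) (66 + (33 + j)) =
    tb (gens.getD i 0) (66 + j) := by decide +kernel
  rw [h, A66_apply]

theorem B66_apply (i j : Fin 33) : B66 F i j =
    cond (tb (gens.getD i 0) (66 + (33 + j))) 1 0 := by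
  have h : ∀ i j : Fin 33, tb (gens.getD i 0) (66 + (33 + j)) = decide (((j - i : Fin 33) : ℕ) + 1 ∈
      ({3, 4, 5, 8, 10, 11, 12, 16, 20, 21, 25, 26, 28, 29, 30, 33} : Finset ℕ)) := by
    decide +kernel
  rw [h, B66, circulantOfFirstRow, Matrix.transpose_apply, Matrix.circulant_apply,
    vectorOfSupport, Bool.cond_decide]

theorem B66_apply' (i j : Fin 33) : B66 F j i =
    cond (tb (gens.getD (33 + i) 0) (66 + j)) 1 0 := by
  have h : ∀ i j : Fin 33, tb (gens.getD (33 + i) 0) (66 + j) =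
    tb (gens.getD j 0) (66 + (33 + i)) := by decide +kernel
  rw [h, B66_apply]

theorem A66_isSymm : (A66 F).IsSymm := by
  have h : ∀ i j : Fin 33, tb (gens.getD i 0) (66 + j) = tb (gens.getD j 0) (66 + i) := by
    decide +kernel
  exact Matrix.IsSymm.ext fun i j => by rw [A66_apply, A66_apply, h]

theorem A66_diag (i : Fin 33) : A66 F i i = 0 := by
  have h : ∀ i : Fin 33, tb (gens.getD i 0) (66 + i) = false := by decide +kernel
  rw [A66_apply, h]
  rfl

/-- The upper bits of the generators are the matrix with blocks `A`, `B`, `Bᵀ` and `A`. -/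
theorem blockMatrix_apply (i j : Fin 66) : blockMatrix (A66 F) (B66 F) i j =
    cond (tb (gens.getD i 0) (66 + j)) 1 0 := by
  obtain ⟨i, rfl⟩ := (finSumFinEquiv (m := 33) (n := 33)).surjective i
  obtain ⟨j, rfl⟩ := (finSumFinEquiv (m := 33) (n := 33)).surjective j
  rw [blockMatrix, Matrix.reindex_apply, Matrix.submatrix_apply, Equiv.symm_apply_apply,
    Equiv.symm_apply_apply]
  rcases i with i | i <;> rcases j with j | j
  · exact A66_apply F i j
  · exact B66_apply F i j
  · exact B66_apply' F i j
  · exact A66_apply' F i j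

theorem blockMatrix_isSymm : (blockMatrix (A66 F) (B66 F)).IsSymm :=
  (Matrix.IsSymm.fromBlocks (A66_isSymm F) rfl (A66_isSymm F)).submatrix _

end

section
variable {F : Type*} [Field F] (ω : F)

/-- The codeword encoded by the natural number `W`. -/
def codeword (W : ℕ) : Fin 66 → F := fun v => ofBits ω (tb W (66 + v)) (tb W v)

theorem codeword_xor (h2 : (2 : F) = 0) (W W' : ℕ) :
    codeword ω (W ^^^ W') = codeword ω W + codeword ω W' :=
  funext fun v => by simp only [codeword, tb_xor, ofBits_xor h2, Pi.add_apply]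

theorem codeword_zero : codeword ω 0 = 0 := funext fun v => by simp [codeword, ofBits]

theorem codeword_gens (i : Fin 66) : codeword ω (gens.getD i 0) =
    (blockMatrix (A66 F) (B66 F) + ω • (1 : Matrix (Fin 66) (Fin 66) F)) i := by
  funext j
  have h : ∀ i j : Fin 66, tb (gens.getD i 0) j = decide (i = j) := by decide +kernel
  rw [codeword, ofBits, h, Matrix.add_apply, blockMatrix_apply, Matrix.smul_apply,
    Matrix.one_apply, smul_eq_mul, Bool.cond_decide]

theorem mem_C66_iff (h2 : (2 : F) = 0) {c : Fin 66 → F} :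
    c ∈ C66 ω ↔ ∃ W, XorSpan gens W ∧ codeword ω W = c := by
  have hlen : gens.length = 66 := by simp [gens]
  constructor
  · intro hc
    induction hc using AddSubgroup.closure_induction with
    | mem c hc =>
      obtain ⟨i, rfl⟩ := hc
      refine ⟨gens.getD i 0, ?_, codeword_gens ω i⟩
      rw [List.getD_eq_getElem _ _ (hlen.symm ▸ i.2), ← Nat.xor_zero gens[_]]
      exact .xor (List.getElem_mem _) .zero
    | zero => exact ⟨0, .zero, codeword_zero ω⟩
    | add c c' _ _ ih ih' =>
      obtain ⟨W, hW, rfl⟩ := ih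
      obtain ⟨W', hW', rfl⟩ := ih'
      refine ⟨W ^^^ W', ?_, codeword_xor ω h2 W W'⟩
      clear * - hW hW'
      induction hW with
      | zero => rwa [Nat.zero_xor]
      | xor hg _ ih => rw [Nat.xor_assoc]; exact .xor hg ih
    | neg c _ ih =>
      have : -c = c := funext fun i => by rw [Pi.neg_apply]; linear_combination -(c i) * h2
      rwa [this]
  · rintro ⟨W, hW, rfl⟩
    induction hW with
    | zero => rw [codeword_zero]; exact zero_mem _
    | xor hg _ ih =>
      rw [codeword_xor ω h2]
      obtain ⟨i, hi, rfl⟩ := List.getElem_of_mem hg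
      refine add_mem (AddSubgroup.subset_closure ⟨⟨i, hi.trans_eq hlen⟩, ?_⟩) ih
      rw [← List.getD_eq_getElem _ 0 hi]
      exact (codeword_gens ω ⟨i, hi.trans_eq hlen⟩).symm

theorem hammingNorm_codeword [DecidableEq F] (h2 : (2 : F) = 0) (hω : ω ^ 2 = ω + 1) (W : ℕ) :
    hammingNorm (codeword ω W) = (List.range 66).countP (nz W) := by
  have h : ∀ v : Fin 66, codeword ω W v ≠ 0 ↔ nz W v = true := fun v => by
    rw [codeword, Ne, ofBits_eq_zero h2 hω, Bool.not_eq_false, nz, Bool.or_comm]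
    rfl
  rw [hammingNorm, ← List.map_coe_finRange_eq_range, List.countP_map, List.countP_eq_length_filter,
    Finset.filter_congr fun v _ => h v]
  refine (congrArg List.length (List.filter_congr fun v _ => ?_) :)
  simp

end

/-- A word of weight `17`, found by a computer search. -/
def word17 : ℕ :=
  ([13, 17, 19, 20, 23, 25, 27, 28, 33, 35, 47].map fun i => gens.getD i 0).foldr Nat.xor 0

theorem xorSpan_word17 : XorSpan gens word17 := by
  have key : ∀ l : List ℕ, (∀ g ∈ l, g ∈ gens) → XorSpan gens (l.foldr Nat.xor 0) := by
    intro l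
    induction l with
    | nil => exact fun _ => .zero
    | cons g l ih => exact fun h => .xor (h g (by simp)) (ih fun x hx => h x (by simp [hx]))
  exact key _ (by decide +kernel)

theorem weight_word17 : (List.range 66).countP (nz word17) = 17 := by decide +kernel

/-! ### The minimum weight -/

theorem countP_eq_zero_of_left_le {W : ℕ} (hW : XorSpan gens W)
    (hle : (List.range 33).countP (nz W) ≤ (List.range' 33 33).countP (nz W))
    (h16 : (List.range 33).countP (nz W) + (List.range' 33 33).countP (nz W) ≤ 16) :
    (List.range 33).countP (nz W) + (List.range' 33 33).countP (nz W) = 0 := by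
  by_cases h4 : (List.range 33).countP (nz W) ≤ 4
  · exact Case.countP_eq_zero case4_covered case4_checked hW h4
      (show _ ≤ 16 by omega) h16
  by_cases h5 : (List.range 33).countP (nz W) ≤ 5
  · exact Case.countP_eq_zero case5_covered case5_checked hW h5
      (show _ ≤ 11 by omega) h16
  by_cases h6 : (List.range 33).countP (nz W) ≤ 6
  · exact Case.countP_eq_zero case6_covered case6_checked hW h6
      (show _ ≤ 10 by omega) h16
  by_cases h7 : (List.range 33).countP (nz W) ≤ 7
  · exact Case.countP_eq_zero case7_covered case7_checked hW h7
      (show _ ≤ 9 by omega) h16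
  · exact Case.countP_eq_zero case8_covered case8_checked hW
      (show _ ≤ 8 by omega) (show _ ≤ 8 by omega) h16

theorem weight_eq_zero {W : ℕ} (hW : XorSpan gens W)
    (h16 : (List.range 66).countP (nz W) ≤ 16) : (List.range 66).countP (nz W) = 0 := by
  rw [range_66, List.countP_append] at h16 ⊢
  rcases le_total ((List.range 33).countP (nz W)) ((List.range' 33 33).countP (nz W)) with h | h
  · exact countP_eq_zero_of_left_le hW h h16
  · obtain ⟨W', hW', hnz⟩ := exists_swap hW
    have hl := countP_of_perm hnz (fun _ => lt_range) half_swap_perm.1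
    have hr := countP_of_perm hnz (fun _ => lt_range') half_swap_perm.2
    rw [← hl, ← hr] at h h16 ⊢
    rw [add_comm] at h16 ⊢
    exact countP_eq_zero_of_left_le hW' h h16

theorem seventeen_le_hammingNorm {F : Type*} [Field F] [DecidableEq F] (h2 : (2 : F) = 0) {ω : F}
    (hω : ω ^ 2 = ω + 1) {c : Fin 66 → F} (hc : c ∈ C66 ω) (h0 : c ≠ 0) : 17 ≤ hammingNorm c := by
  obtain ⟨W, hW, rfl⟩ := (mem_C66_iff ω h2).1 hc
  by_contra h
  refine h0 (hammingNorm_eq_zero.1 ?_)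
  rw [hammingNorm_codeword ω h2 hω] at h ⊢
  exact weight_eq_zero hW (by omega)

end AdditiveCode

theorem proposition3 {F : Type*} [Field F] [Fintype F] [DecidableEq F]
    (hF : Fintype.card F = 4) (ω : F) (hω : ω ^ 2 = ω + 1) :
    (AdditiveCode.A66 F).IsSymm ∧
    (∀ i, AdditiveCode.A66 F i i = 0) ∧
    AdditiveCode.IsSelfDual (AdditiveCode.C66 ω) ∧
    AdditiveCode.HasMinimumWeight (AdditiveCode.C66 ω) 17 := by
  open AdditiveCode in
  have h2 := two_eq_zero_of_card hF
  refine ⟨A66_isSymm F, A66_diag F, isSelfDual_rowCode hF hω (fun i j => ?_)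
    (blockMatrix_isSymm F), ⟨codeword ω word17, (mem_C66_iff ω h2).2 ⟨_, xorSpan_word17, rfl⟩,
      ?_, ?_⟩, ?_⟩
  · rw [blockMatrix_apply]
    cases tb (gens.getD i 0) (66 + j) <;> simp
  · rw [← hammingNorm_ne_zero_iff, hammingNorm_codeword ω h2 hω, weight_word17]
    norm_num
  · rw [hammingNorm_codeword ω h2 hω, weight_word17]
  · rintro _ ⟨c, hc, h0, rfl⟩
    exact seventeen_le_hammingNorm h2 hω hc h0
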